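/- Let $\mathbb K$ be a field of characteristic zero and let $G$ be a finite graph on the vertex set $\{0,1,\dots,n\}$, $n\ge 0$, without loops (multiple edges are allowed; in particular $G$ may be any simple graph). For $I\subseteq\{0,\dots,n\}$ let $D_I$ be the number of edges of $G$ between $I$ and its complement. For a vertex $i$ and an edge $e$ put $c_{i,e}=1$ if $e$ joins $i$ to a vertex $j>i$, $c_{i,e}=-1$ if $e$ joins $i$ to a vertex $j<i$, and $c_{i,e}=0$ otherwise. Let $\Phi_G^T$ be the commutative $\mathbb K$-algebra generated by variables $\phi_e$, one for each edge $e$ of $G$, with the defining relations $\phi_e^2=0$ for every edge $e$, and $\prod_{e\in H}\phi_e=0$ for every set $H$ of edges such that the graph $G\setminus H$ (with all vertices $0,\dots,n$ kept) is not connected. Define the following algebras. * $\mathcal B_G^T=\mathbb K[x_1,\dots,x_n]/\mathcal J_G^T$, where $\mathcal J_G^T$ is generated by $\left(\sum_{i\in I}x_i\right)^{D_I}$ for all nonempty $I\subseteq\{1,\dots,n\}$. * $\mathcal C_G^T\subseteq\Phi_G^T$ is the (unital) subalgebra generated by $X_i^T=\sum_{e}c_{i,e}\phi_e$, $i=1,\dots,n$.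 * $\mathcal D_G^T=\mathbb K[y_0,\dots,y_n]/\mathcal I_G^T$, where $\mathcal I_G^T$ is generated by $\left(\prod_{i\in I}y_i-1\right)^{D_I}$ for all nonempty proper subsets $I\subset\{0,\dots,n\}$, together with $\prod_{i=0}^n y_i-1$. * $\mathcal K_G^T\subseteq\Phi_G^T$ is the (unital) subalgebra generated by $Y_i^T=\exp(X_i^T)=\prod_{e}(1+c_{i,e}\phi_e)$, $i=0,\dots,n$. Then $\mathcal B_G^T$, $\mathcal C_G^T$, $\mathcal D_G^T$ and $\mathcal K_G^T$ are isomorphic as (non-filtered) $\mathbb K$-algebras, and the dimension of each of them over $\mathbb K$ is equal to the number of spanning trees of $G$. -/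

import Mathlib

noncomputable section

namespace TreeAlgebra

/-! Graphs are multigraphs `G : Graph (Fin (n + 1)) β`; in the theorem the vertex set is all of
`{0, …, n}`, there are no loops and the edge set is finite. Edge subsets are taken in `G.edgeSet`. -/

/-- The adjacency graph, on all the vertices `0, …, n`, of the spanning subgraph of `G` with
edge set `S` (parallel edges of `S` are merged). -/
def adjGraph {n : ℕ} {β : Type*} (G : Graph (Fin (n + 1)) β) (S : Set G.edgeSet) :
    SimpleGraph (Fin (n + 1)) where
  Adj i j := i ≠ j ∧ ∃ e ∈ S, G.IsLink (e : β) i j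
  symm := ⟨fun _ _ h => ⟨h.1.symm, h.2.imp fun _ he => ⟨he.1, he.2.symm⟩⟩⟩
  loopless := ⟨fun _ h => h.1 rfl⟩

/-- A set `H` of edges is slim if its complement `G \ H` (keeping all vertices) is connected. -/
def IsSlim {n : ℕ} {β : Type*} (G : Graph (Fin (n + 1)) β) (H : Set G.edgeSet) : Prop :=
  (adjGraph G Hᶜ).Connected

/-- `T` is the edge set of a spanning tree of a loopless `G`: it contains no two parallel edges
(no cycle of length two), and the graph on `{0, …, n}` that it forms is a tree. -/
def IsSpanningTree {n : ℕ} {β : Type*} (G : Graph (Fin (n + 1)) β) (T : Set G.edgeSet) : Prop :=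
  (adjGraph G T).IsTree ∧
    ∀ e ∈ T, ∀ f ∈ T, ∀ i j, G.IsLink (e : β) i j → G.IsLink (f : β) i j → e = f

/-- The number of spanning trees of `G` (used only for a finite edge set). -/
def numSpanningTrees {n : ℕ} {β : Type*} (G : Graph (Fin (n + 1)) β) : ℕ :=
  {T : Set G.edgeSet | IsSpanningTree G T}.ncard

/-- `D_I`, the number of edges between `I` and its complement (used only for a finite edge set). -/
def cutSize {n : ℕ} {β : Type*} (G : Graph (Fin (n + 1)) β) (I : Finset (Fin (n + 1))) : ℕ :=
  {e : G.edgeSet | ∃ i ∈ I, ∃ j ∉ I, G.IsLink (e : β) i j}.ncard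

open Classical in
/-- `c_{i,e}`: `1` if `e` joins `i` to some `j > i`, `-1` if `e` joins `i` to some `j < i`,
and `0` if `e` is not incident to `i`. -/
def sgn (K : Type*) [Field K] {n : ℕ} {β : Type*} (G : Graph (Fin (n + 1)) β)
    (i : Fin (n + 1)) (e : G.edgeSet) : K :=
  if ∃ j, G.IsLink (e : β) i j ∧ i < j then 1
  else if ∃ j, G.IsLink (e : β) i j ∧ j < i then -1
  else 0

/-- The relations of `Φ_G^T`: squares of the edge variables, and the products of the edge
variables over the non-slim sets of edges. -/
def phiIdeal (K : Type*) [Field K] {n : ℕ} {β : Type*} (G : Graph (Fin (n + 1)) β) :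
    Ideal (MvPolynomial G.edgeSet K) :=
  Ideal.span
    ({p | ∃ e : G.edgeSet, p = MvPolynomial.X e ^ 2} ∪
      {p | ∃ H : Finset G.edgeSet, ¬ IsSlim G (H : Set G.edgeSet) ∧
        p = ∏ e ∈ H, MvPolynomial.X e})

/-- The algebra `Φ_G^T`. -/
abbrev PhiT (K : Type*) [Field K] {n : ℕ} {β : Type*} (G : Graph (Fin (n + 1)) β) : Type _ :=
  MvPolynomial G.edgeSet K ⧸ phiIdeal K G

/-- The generator `φ_e` of `Φ_G^T`. -/
def phi (K : Type*) [Field K] {n : ℕ} {β : Type*} (G : Graph (Fin (n + 1)) β) (e : G.edgeSet) :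
    PhiT K G :=
  Ideal.Quotient.mk (phiIdeal K G) (MvPolynomial.X e)

/-- `X_i^T = ∑_e c_{i,e} φ_e`. -/
def genX (K : Type*) [Field K] {n : ℕ} {β : Type*} (G : Graph (Fin (n + 1)) β)
    [Fintype G.edgeSet] (i : Fin (n + 1)) : PhiT K G :=
  ∑ e : G.edgeSet, sgn K G i e • phi K G e

/-- `Y_i^T = exp (X_i^T) = ∏_e (1 + c_{i,e} φ_e)`. -/
def genY (K : Type*) [Field K] {n : ℕ} {β : Type*} (G : Graph (Fin (n + 1)) β)
    [Fintype G.edgeSet] (i : Fin (n + 1)) : PhiT K G :=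
  ∏ e : G.edgeSet, (1 + sgn K G i e • phi K G e)

/-- `C_G^T`, the subalgebra of `Φ_G^T` generated by `X_1^T, …, X_n^T`. -/
def CT (K : Type*) [Field K] {n : ℕ} {β : Type*} (G : Graph (Fin (n + 1)) β)
    [Fintype G.edgeSet] : Subalgebra K (PhiT K G) :=
  Algebra.adjoin K (Set.range fun i : Fin n => genX K G i.succ)

/-- `K_G^T`, the subalgebra of `Φ_G^T` generated by `Y_0^T, …, Y_n^T`. -/
def KT (K : Type*) [Field K] {n : ℕ} {β : Type*} (G : Graph (Fin (n + 1)) β)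
    [Fintype G.edgeSet] : Subalgebra K (PhiT K G) :=
  Algebra.adjoin K (Set.range fun i : Fin (n + 1) => genY K G i)

/-- The ideal generated by `(∑_{i ∈ I} x_i) ^ D_I`, for nonempty `I ⊆ {1, …, n}`. The variable of
the vertex `i.succ` is indexed by `i : Fin n`. -/
def idealBT (K : Type*) [Field K] {n : ℕ} {β : Type*} (G : Graph (Fin (n + 1)) β) :
    Ideal (MvPolynomial (Fin n) K) :=
  Ideal.span {p | ∃ I : Finset (Fin n), I.Nonempty ∧
    p = (∑ i ∈ I, MvPolynomial.X i) ^ cutSize G (I.map (Fin.succEmb n))}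

/-- `B_G^T`. -/
abbrev BT (K : Type*) [Field K] {n : ℕ} {β : Type*} (G : Graph (Fin (n + 1)) β) : Type _ :=
  MvPolynomial (Fin n) K ⧸ idealBT K G

/-- The ideal generated by `(∏_{i ∈ I} y_i - 1) ^ D_I`, for nonempty proper `I ⊂ {0, …, n}`,
and by `y_0 ⋯ y_n - 1`. -/
def idealDT (K : Type*) [Field K] {n : ℕ} {β : Type*} (G : Graph (Fin (n + 1)) β) :
    Ideal (MvPolynomial (Fin (n + 1)) K) :=
  Ideal.span
    ({q | ∃ I : Finset (Fin (n + 1)), I.Nonempty ∧ I ≠ Finset.univ ∧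
        q = (∏ i ∈ I, MvPolynomial.X i - 1) ^ cutSize G I} ∪
      {∏ i : Fin (n + 1), MvPolynomial.X i - 1})

/-- `D_G^T`. -/
abbrev DT (K : Type*) [Field K] {n : ℕ} {β : Type*} (G : Graph (Fin (n + 1)) β) : Type _ :=
  MvPolynomial (Fin (n + 1)) K ⧸ idealDT K G

end TreeAlgebra

end

/-! The core is a deletion-contraction argument for the incidence vectors `c e` in `K ^ n`, showing
that `idealBT` is the kernel of `x_i ↦ X_i^T` and that its codimension counts bases, which are the
spanning trees.

One inclusion is direct: `∑_{i ∈ I} X_i^T` is a signed sum of the square-zero `φ_e` over the cut of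
`I`, so its `D_I`-th power is a multiple of the product over that cut, whose removal disconnects
`G`. For the converse, generalise to disjoint sets `S` (contracted) and `R` (remaining): polynomials
killed by the directional derivatives along `S`, modulo powers of the forms `sumX K I` that are
constant along `S`. Under the substitution, the derivative along `e` becomes `∂/∂φ_e`, so it reads
off the coefficients of squarefree monomials containing `e`. If `c e` is not in the span of `S`, it
maps the ideal for `(S, R ∪ {e})` onto the ideal for the deletion `(S, R)`, and its kernel on the
invariants is the ring of the contraction `(S ∪ {e}, R)`. Thus a polynomial with vanishing slim
coefficients is corrected by a lift of its derivative, and the difference is handled by the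
contraction (`mem_powerIdeal_of_mem_slimKernel`). The same short exact sequence gives the recursion
for dimensions, matching that for bases (`rank_invariants_quotient_powerIdeal`). The property
`HasLevels` ensures that 0-1 forms suffice to detect spans.

The multiplicative algebras are reached by exponentials and logarithms of nilpotents: `exp a - 1` is
`a` times a unit, so the relations of `B` and `D` correspond, and `C` and `K` are the same
subalgebra. -/

namespace TreeAlgebra

open MvPolynomial

/-! ### Directional derivatives and power ideals of a vector arrangement. -/

section Arrangement

variable {K : Type*} [Field K] {n : ℕ} {E : Type*}

/-- The derivation `∑ i, c e i • ∂ / ∂ x_i`. -/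
noncomputable def edgeDeriv (c : E → Fin n → K) (e : E) :
    Derivation K (MvPolynomial (Fin n) K) (MvPolynomial (Fin n) K) :=
  mkDerivation K fun i => C (c e i)

/-- The linear form `∑ i ∈ I, x_i`. -/
noncomputable def sumX (K : Type*) [Field K] {n : ℕ} (I : Finset (Fin n)) :
    MvPolynomial (Fin n) K := ∑ i ∈ I, X i

/-- The derivative of `sumX K I` in the direction `c e`. -/
def weight (c : E → Fin n → K) (e : E) (I : Finset (Fin n)) : K := ∑ i ∈ I, c e i

/-- `T` meets the support of every nonempty index set. -/
def Crosses (c : E → Fin n → K) (T : Finset E) : Prop :=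
  ∀ I : Finset (Fin n), I.Nonempty → ∃ e ∈ T, weight c e I ≠ 0

open Classical in
/-- The number of elements of `R` on which the weight of `I` does not vanish. -/
noncomputable def mult (c : E → Fin n → K) (R : Finset E) (I : Finset (Fin n)) : ℕ :=
  (R.filter fun e => weight c e I ≠ 0).card

/-- The polynomials annihilated by all the derivations `edgeDeriv c e`, `e ∈ S`. -/
noncomputable def invariants (c : E → Fin n → K) (S : Finset E) :
    Submodule K (MvPolynomial (Fin n) K) :=
  ⨅ e ∈ S, LinearMap.ker (edgeDeriv c e).toLinearMap

/-- The ideal of `invariants c S` generated by the powers `sumX K I ^ mult c R I`. -/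
noncomputable def powerIdeal (c : E → Fin n → K) (S R : Finset E) :
    Submodule K (MvPolynomial (Fin n) K) :=
  Submodule.span K {p | ∃ g ∈ invariants c S, ∃ I : Finset (Fin n), I.Nonempty ∧
    (∀ f ∈ S, weight c f I = 0) ∧ p = sumX K I ^ mult c R I * g}

/-- The substitution `x_i ↦ ∑ e, c e i φ_e`. -/
noncomputable def edgeSubst [Fintype E] (c : E → Fin n → K) :
    MvPolynomial (Fin n) K →ₐ[K] MvPolynomial E K :=
  aeval fun i => ∑ e, c e i • X e

/-- The exponent of the squarefree monomial on `H`. -/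
noncomputable def indExp (H : Finset E) : E →₀ ℕ := ∑ e ∈ H, Finsupp.single e 1

open Classical in
/-- The polynomials `p` such that all the coefficients of `edgeSubst c p` at slim sets vanish. -/
def slimKernel [Fintype E] (c : E → Fin n → K) (S R : Finset E) :
    Set (MvPolynomial (Fin n) K) :=
  {p | ∀ H ⊆ R, Crosses c (R \ H ∪ S) → coeff (indExp H) (edgeSubst c p) = 0}

variable (c : E → Fin n → K)

lemma edgeDeriv_X (e : E) (i : Fin n) : edgeDeriv c e (X i) = C (c e i) :=
  mkDerivation_X _ _ _

lemma edgeDeriv_C (e : E) (a : K) : edgeDeriv c e (C a) = 0 :=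
  derivation_C _ _

lemma edgeDeriv_sumX (e : E) (I : Finset (Fin n)) :
    edgeDeriv c e (sumX K I) = C (weight c e I) := by
  simp [sumX, weight, edgeDeriv_X, map_sum]

lemma edgeDeriv_comm (e f : E) (p : MvPolynomial (Fin n) K) :
    edgeDeriv c e (edgeDeriv c f p) = edgeDeriv c f (edgeDeriv c e p) := by
  have h : ⁅edgeDeriv c e, edgeDeriv c f⁆ = 0 := by
    apply derivation_ext
    intro i
    simp [Derivation.commutator_apply, edgeDeriv_X]
  have := congrArg (fun D => D p) h
  simpa [Derivation.commutator_apply, sub_eq_zero] using this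

lemma edgeDeriv_pow_mul (e : E) (I : Finset (Fin n)) (k : ℕ) (g : MvPolynomial (Fin n) K) :
    edgeDeriv c e (sumX K I ^ (k + 1) * g) =
      C ((k + 1) * weight c e I) * (sumX K I ^ k * g) + sumX K I ^ (k + 1) * edgeDeriv c e g := by
  rw [Derivation.leibniz, Derivation.leibniz_pow, edgeDeriv_sumX]
  simp only [smul_eq_mul, nsmul_eq_mul, Nat.add_sub_cancel, map_mul, map_add, map_natCast, map_one,
    Nat.cast_add, Nat.cast_one]
  ring

lemma mem_invariants {S : Finset E} {p : MvPolynomial (Fin n) K} :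
    p ∈ invariants c S ↔ ∀ e ∈ S, edgeDeriv c e p = 0 := by
  simp [invariants, Submodule.mem_iInf]

lemma mul_mem_invariants {S : Finset E} {p q : MvPolynomial (Fin n) K}
    (hp : p ∈ invariants c S) (hq : q ∈ invariants c S) : p * q ∈ invariants c S := by
  rw [mem_invariants] at *
  intro e he
  rw [Derivation.leibniz, hp e he, hq e he, smul_zero, smul_zero, add_zero]

lemma C_mem_invariants {S : Finset E} (a : K) : C a ∈ invariants c S :=
  (mem_invariants c).2 fun e _ => edgeDeriv_C c e a

lemma C_mul_mem {U : Submodule K (MvPolynomial (Fin n) K)} (a : K) {p : MvPolynomial (Fin n) K}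
    (hp : p ∈ U) : C a * p ∈ U := by
  rw [← smul_eq_C_mul]
  exact U.smul_mem a hp

lemma sumX_pow_mem_invariants {S : Finset E} {I : Finset (Fin n)}
    (h : ∀ f ∈ S, weight c f I = 0) (k : ℕ) : sumX K I ^ k ∈ invariants c S := by
  induction k with
  | zero => simpa using C_mem_invariants c (S := S) (1 : K)
  | succ k ih =>
    rw [pow_succ]
    refine mul_mem_invariants c ih ((mem_invariants c).2 fun f hf => ?_)
    rw [edgeDeriv_sumX, h f hf, map_zero]

lemma edgeDeriv_mem_invariants {S : Finset E} (e : E) {p : MvPolynomial (Fin n) K}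
    (hp : p ∈ invariants c S) : edgeDeriv c e p ∈ invariants c S := by
  rw [mem_invariants] at *
  intro f hf
  rw [edgeDeriv_comm, hp f hf, map_zero]

lemma powerIdeal_le_invariants (S R : Finset E) : powerIdeal c S R ≤ invariants c S := by
  refine Submodule.span_le.2 ?_
  rintro _ ⟨g, hg, I, -, hI, rfl⟩
  exact mul_mem_invariants c (sumX_pow_mem_invariants c hI _) hg

lemma exists_iterate_edgeDeriv_eq_zero (e : E) (p : MvPolynomial (Fin n) K) :
    ∃ r, (edgeDeriv c e)^[r] p = 0 := by
  have hz : ∀ k, (edgeDeriv c e)^[k] (0 : MvPolynomial (Fin n) K) = 0 := fun k =>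
    Function.iterate_fixed (map_zero _) k
  have hadd : ∀ k (p q : MvPolynomial (Fin n) K),
      (edgeDeriv c e)^[k] (p + q) = (edgeDeriv c e)^[k] p + (edgeDeriv c e)^[k] q := fun k p q =>
    iterate_map_add (edgeDeriv c e) k p q
  have hC : ∀ k (a : K) (p : MvPolynomial (Fin n) K),
      (edgeDeriv c e)^[k] (p * C a) = (edgeDeriv c e)^[k] p * C a := by
    intro k a
    induction k with
    | zero => simp
    | succ k ih =>
      intro p
      rw [Function.iterate_succ_apply, Function.iterate_succ_apply, ← ih, Derivation.leibniz,
        edgeDeriv_C, smul_zero, zero_add, smul_eq_mul, mul_comm]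
  have hle : ∀ {k l : ℕ}, k ≤ l → ∀ p : MvPolynomial (Fin n) K,
      (edgeDeriv c e)^[k] p = 0 → (edgeDeriv c e)^[l] p = 0 := by
    intro k l hkl p hp
    obtain ⟨m, rfl⟩ := Nat.exists_eq_add_of_le hkl
    rw [add_comm, Function.iterate_add_apply, hp, hz]
  induction p using MvPolynomial.induction_on with
  | C a => exact ⟨1, edgeDeriv_C c e a⟩
  | add p q hp hq =>
    obtain ⟨r, hr⟩ := hp
    obtain ⟨s, hs⟩ := hq
    exact ⟨max r s, by rw [hadd, hle (le_max_left r s) _ hr, hle (le_max_right r s) _ hs, add_zero]⟩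
  | mul_X p i hp =>
    have key : ∀ r (p : MvPolynomial (Fin n) K), (edgeDeriv c e)^[r] p = 0 →
        (edgeDeriv c e)^[r + 1] (p * X i) = 0 := by
      intro r
      induction r with
      | zero =>
        intro p hp
        have : p = 0 := hp
        simp [this]
      | succ r ih =>
        intro p hp
        rw [Function.iterate_succ_apply, Derivation.leibniz, edgeDeriv_X, hadd, smul_eq_mul,
          smul_eq_mul, hC, hp, zero_mul, zero_add, mul_comm]
        exact ih _ hp
    obtain ⟨r, hr⟩ := hp
    exact ⟨r + 1, key r p hr⟩

/-- Integration by parts: the naive primitive leaves an error involving the derivative of `g`. Since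
the derivation is locally nilpotent, repeating the correction terminates. -/
lemma exists_edgeDeriv_pow_mul_eq [CharZero K] {S : Finset E} {e : E} {I : Finset (Fin n)}
    (hI : ∀ f ∈ S, weight c f I = 0) (he : weight c e I ≠ 0) {g : MvPolynomial (Fin n) K}
    (hg : g ∈ invariants c S) (k : ℕ) :
    ∃ h ∈ invariants c S, edgeDeriv c e (sumX K I ^ (k + 1) * h) = sumX K I ^ k * g := by
  obtain ⟨r, hr⟩ := exists_iterate_edgeDeriv_eq_zero c e g
  induction r generalizing g k with
  | zero =>
    have : g = 0 := hr
    exact ⟨0, zero_mem _, by simp [this]⟩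
  | succ r ih =>
    obtain ⟨h, hh, hh'⟩ := ih (edgeDeriv_mem_invariants c e hg) (k + 1) hr
    have hne : ((k : K) + 1) * weight c e I ≠ 0 := mul_ne_zero (Nat.cast_add_one_ne_zero k) he
    -- Here `h` is a primitive for the error term `sumX K I ^ (k + 1) * edgeDeriv c e g`, so
    -- subtracting `sumX K I * h` cancels that error.
    refine ⟨C (((k : K) + 1) * weight c e I)⁻¹ * (g - sumX K I * h), C_mul_mem _
      (sub_mem hg (mul_mem_invariants c ?_ hh)), ?_⟩
    · simpa using sumX_pow_mem_invariants c hI 1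
    · have h1 : sumX K I ^ (k + 1) * (C (((k : K) + 1) * weight c e I)⁻¹ * (g - sumX K I * h)) =
          C (((k : K) + 1) * weight c e I)⁻¹ *
            (sumX K I ^ (k + 1) * g - sumX K I ^ (k + 1 + 1) * h) := by ring
      rw [h1, ← smul_eq_C_mul, Derivation.map_smul, map_sub, hh', edgeDeriv_pow_mul,
        add_sub_cancel_right, smul_eq_C_mul, ← mul_assoc, ← map_mul, inv_mul_cancel₀ hne, map_one,
        one_mul]

lemma mult_of_weight_eq_zero [DecidableEq E] {R : Finset E} {e : E} {I : Finset (Fin n)}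
    (h : weight c e I = 0) : mult c (insert e R) I = mult c R I := by
  classical
  unfold mult
  congr 1
  ext f
  simp only [Finset.mem_filter, Finset.mem_insert]
  constructor
  · rintro ⟨rfl | hf, hw⟩
    · exact absurd h hw
    · exact ⟨hf, hw⟩
  · rintro ⟨hf, hw⟩
    exact ⟨Or.inr hf, hw⟩

lemma mult_of_weight_ne_zero [DecidableEq E] {R : Finset E} {e : E} (heR : e ∉ R)
    {I : Finset (Fin n)} (h : weight c e I ≠ 0) : mult c (insert e R) I = mult c R I + 1 := by
  classical
  unfold mult
  rw [← Finset.card_insert_of_notMem (a := e) (s := R.filter fun e => weight c e I ≠ 0)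
    (by simp [heR])]
  congr 1
  ext f
  simp only [Finset.mem_filter, Finset.mem_insert]
  constructor
  · rintro ⟨rfl | hf, hw⟩
    · exact Or.inl rfl
    · exact Or.inr ⟨hf, hw⟩
  · rintro (rfl | ⟨hf, hw⟩)
    · exact ⟨Or.inl rfl, h⟩
    · exact ⟨Or.inr hf, hw⟩

/-- By the Leibniz rule a derivative lowers the exponent by one only if `e` has nonzero weight on
`I`, which is when deleting `e` lowers the multiplicity. -/
lemma edgeDeriv_mem_powerIdeal [DecidableEq E] {S R : Finset E} {e : E} (heR : e ∉ R)
    {p : MvPolynomial (Fin n) K} (hp : p ∈ powerIdeal c S (insert e R)) :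
    edgeDeriv c e p ∈ powerIdeal c S R := by
  suffices h : powerIdeal c S (insert e R) ≤
      (powerIdeal c S R).comap (edgeDeriv c e).toLinearMap from h hp
  refine Submodule.span_le.2 ?_
  rintro _ ⟨g, hg, I, hne, hI, rfl⟩
  change edgeDeriv c e _ ∈ powerIdeal c S R
  have hmem : ∀ g ∈ invariants c S, sumX K I ^ mult c R I * g ∈ powerIdeal c S R :=
    fun g hg => Submodule.subset_span ⟨g, hg, I, hne, hI, rfl⟩
  by_cases hw : weight c e I = 0
  · rw [mult_of_weight_eq_zero c hw, Derivation.leibniz, Derivation.leibniz_pow, edgeDeriv_sumX, hw,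
      map_zero, smul_zero, smul_zero, smul_zero, add_zero, smul_eq_mul]
    exact hmem _ (edgeDeriv_mem_invariants c e hg)
  · rw [mult_of_weight_ne_zero c heR hw, edgeDeriv_pow_mul, pow_succ, mul_assoc (_ ^ _)]
    refine add_mem (C_mul_mem _ (hmem _ hg)) (hmem _ ?_)
    refine mul_mem_invariants c ?_ (edgeDeriv_mem_invariants c e hg)
    simpa using sumX_pow_mem_invariants c hI 1

lemma exists_mem_powerIdeal_edgeDeriv_eq [CharZero K] [DecidableEq E] {S R : Finset E} {e : E}
    (heR : e ∉ R) {I₀ : Finset (Fin n)} (hI₀ : ∀ f ∈ S, weight c f I₀ = 0)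
    (he : weight c e I₀ ≠ 0) {q : MvPolynomial (Fin n) K} (hq : q ∈ powerIdeal c S R) :
    ∃ p ∈ powerIdeal c S (insert e R), edgeDeriv c e p = q := by
  suffices h : powerIdeal c S R ≤
      (powerIdeal c S (insert e R)).map (edgeDeriv c e).toLinearMap from h hq
  refine Submodule.span_le.2 ?_
  rintro _ ⟨g, hg, I, hne, hI, rfl⟩
  have hmem : ∀ g ∈ invariants c S,
      sumX K I ^ mult c (insert e R) I * g ∈ powerIdeal c S (insert e R) :=
    fun g hg => Submodule.subset_span ⟨g, hg, I, hne, hI, rfl⟩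
  by_cases hw : weight c e I = 0
  -- The power of `sumX K I` is constant along `e`, so only `g` needs a primitive, built with the
  -- auxiliary form `sumX K I₀`.
  · obtain ⟨h, hh, hh'⟩ := exists_edgeDeriv_pow_mul_eq c hI₀ he hg 0
    rw [mult_of_weight_eq_zero c hw] at hmem
    refine ⟨_, hmem (sumX K I₀ ^ (0 + 1) * h)
      (mul_mem_invariants c (sumX_pow_mem_invariants c hI₀ _) hh), ?_⟩
    change edgeDeriv c e _ = _
    rw [Derivation.leibniz, hh', Derivation.leibniz_pow, edgeDeriv_sumX, hw, map_zero, smul_zero,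
      smul_zero, smul_zero, add_zero, smul_eq_mul, pow_zero, one_mul]
  · obtain ⟨h, hh, hh'⟩ := exists_edgeDeriv_pow_mul_eq c hI hw hg (mult c R I)
    rw [mult_of_weight_ne_zero c heR hw] at hmem
    exact ⟨_, hmem h hh, hh'⟩

end Arrangement

/-! ### Separating vectors from spans by index sets. -/

section Separation

variable {K : Type*} [Field K] {n : ℕ} {E : Type*}

open Classical in
/-- A vector orthogonal to `c e` has level sets, away from the zero level, on which `e` has
weight zero. -/
def HasLevels (c : E → Fin n → K) : Prop :=
  ∀ (u : Fin n → K) (e : E) (a : K), a ≠ 0 → ∑ i, c e i * u i = 0 →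
    weight c e (Finset.univ.filter fun i => u i = a) = 0

variable {c : E → Fin n → K}

/-- A functional vanishing on `S` but not at `y` decomposes into its level sets. `HasLevels` makes
each nonzero level orthogonal to `S`, and the zero level contributes nothing, so some nonzero level
must detect `y`. -/
lemma HasLevels.exists_sum_ne_zero (hc : HasLevels c) {S : Finset E} {y : Fin n → K}
    (hy : y ∉ Submodule.span K (c '' S)) :
    ∃ I : Finset (Fin n), I.Nonempty ∧ (∀ f ∈ S, weight c f I = 0) ∧ ∑ i ∈ I, y i ≠ 0 := by
  classical
  obtain ⟨φ, hφ, hle⟩ := Submodule.exists_le_ker_of_notMem hy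
  let u : Fin n → K := fun i => φ fun j => if i = j then 1 else 0
  have hu : ∀ x, φ x = ∑ i, x i * u i := fun x => LinearMap.pi_apply_eq_sum_univ φ x
  by_contra! hcon
  refine hφ ?_
  rw [hu, ← Finset.sum_fiberwise_of_maps_to (t := Finset.univ.image u)
    (fun i _ => Finset.mem_image_of_mem u (Finset.mem_univ i))]
  refine Finset.sum_eq_zero fun a _ => ?_
  have h1 : ∑ i with u i = a, y i * u i = (∑ i with u i = a, y i) * a := by
    rw [Finset.sum_mul]
    refine Finset.sum_congr rfl fun i hi => ?_
    rw [(Finset.mem_filter.1 hi).2]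
  rw [h1]
  by_cases ha : a = 0
  · rw [ha, mul_zero]
  rcases (Finset.univ.filter fun i => u i = a).eq_empty_or_nonempty with h0 | h0
  · rw [h0, Finset.sum_empty, zero_mul]
  rw [hcon _ h0 fun f hf => ?_, zero_mul]
  convert hc u f a ha ?_
  rw [← hu]
  exact hle (Submodule.subset_span ⟨f, hf, rfl⟩)

lemma HasLevels.span_eq_top (hc : HasLevels c) {S : Finset E} (hS : Crosses c S) :
    Submodule.span K (c '' S) = ⊤ := by
  refine eq_top_iff.2 fun y _ => ?_
  by_contra hy
  obtain ⟨I, hne, hI, -⟩ := hc.exists_sum_ne_zero hy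
  obtain ⟨e, he, hw⟩ := hS I hne
  exact hw (hI e he)

lemma Crosses.mono {S T : Finset E} (hS : Crosses c S) (h : S ⊆ T) : Crosses c T := fun I hI =>
  let ⟨e, he, hw⟩ := hS I hI
  ⟨e, h he, hw⟩

lemma eq_C_of_pderiv_eq_zero [CharZero K] {σ : Type*} {p : MvPolynomial σ K}
    (h : ∀ i, pderiv i p = 0) : p = C (coeff 0 p) := by
  classical
  ext m
  rw [coeff_C]
  split_ifs with hm
  · rw [hm]
  obtain ⟨i, hi⟩ := Finsupp.ne_iff.1 (Ne.symm hm)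
  have hle : Finsupp.single i 1 ≤ m := by
    rw [Finsupp.single_le_iff]
    exact Nat.one_le_iff_ne_zero.2 hi
  have h1 := coeff_pderiv (i := i) p (m - Finsupp.single i 1)
  rw [h i, coeff_zero, tsub_add_cancel_of_le hle] at h1
  exact (mul_eq_zero.1 h1.symm).resolve_right (Nat.cast_add_one_ne_zero _)

lemma sum_smul_pderiv (e : E) (p : MvPolynomial (Fin n) K) :
    edgeDeriv c e p = ∑ i, c e i • pderiv i p := by
  have hsum (q : MvPolynomial (Fin n) K) :
      (∑ i, c e i • pderiv i : Derivation K (MvPolynomial (Fin n) K) (MvPolynomial (Fin n) K)) q =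
        ∑ i, c e i • pderiv i q := by
    have := map_sum (Derivation.coeFnAddMonoidHom (R := K) (A := MvPolynomial (Fin n) K)
      (M := MvPolynomial (Fin n) K)) (fun i => c e i • pderiv i) Finset.univ
    exact (congrFun this q).trans (Finset.sum_apply q _ _)
  have h : edgeDeriv c e = ∑ i, c e i • pderiv i := by
    refine derivation_ext fun j => ?_
    rw [edgeDeriv_X, hsum, Finset.sum_eq_single j]
    · simp [smul_eq_C_mul]
    · intro i _ hij
      simp [pderiv_X_of_ne hij.symm]
    · simp
  rw [h, hsum]

lemma eq_C_of_mem_invariants [CharZero K] (hc : HasLevels c) {S : Finset E} (hS : Crosses c S)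
    {p : MvPolynomial (Fin n) K} (hp : p ∈ invariants c S) : p = C (coeff 0 p) := by
  classical
  refine eq_C_of_pderiv_eq_zero fun i => ?_
  have hle : Submodule.span K (c '' S) ≤
      LinearMap.ker (Fintype.linearCombination K fun i => pderiv i p) := by
    refine Submodule.span_le.2 ?_
    rintro _ ⟨e, he, rfl⟩
    change Fintype.linearCombination K _ _ = _
    rw [Fintype.linearCombination_apply, ← sum_smul_pderiv, (mem_invariants c).1 hp e he]
  rw [hc.span_eq_top hS] at hle
  have h1 := hle (Submodule.mem_top (x := Pi.single i 1))
  rw [LinearMap.mem_ker, Fintype.linearCombination_apply_single, one_smul] at h1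
  exact h1

lemma edgeDeriv_eq_zero_of_mem_span {S : Finset E} {e : E}
    (he : c e ∈ Submodule.span K (c '' S)) {p : MvPolynomial (Fin n) K}
    (hp : p ∈ invariants c S) : edgeDeriv c e p = 0 := by
  have hle : Submodule.span K (c '' S) ≤
      LinearMap.ker (Fintype.linearCombination K fun i => pderiv i p) := by
    refine Submodule.span_le.2 ?_
    rintro _ ⟨e, he, rfl⟩
    change Fintype.linearCombination K _ _ = _
    rw [Fintype.linearCombination_apply, ← sum_smul_pderiv, (mem_invariants c).1 hp e he]
  have h1 := hle he
  rwa [LinearMap.mem_ker, Fintype.linearCombination_apply, ← sum_smul_pderiv] at h1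

end Separation

/-! ### Slim coefficients determine the power ideal. -/

section SlimKernel

variable {K : Type*} [Field K] {n : ℕ} {E : Type*} {c : E → Fin n → K}

lemma pderiv_edgeSubst [Fintype E] (e : E) (p : MvPolynomial (Fin n) K) :
    pderiv e (edgeSubst c p) = edgeSubst c (edgeDeriv c e p) := by
  classical
  have hX : ∀ i, edgeSubst c (X i) = ∑ e, c e i • X e := fun i => aeval_X _ _
  have hC : ∀ a, edgeSubst c (C a) = C a := fun a => aeval_C _ _
  induction p using MvPolynomial.induction_on with
  | C a => rw [edgeDeriv_C, hC, pderiv_C, map_zero]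
  | add p q hp hq => rw [map_add, map_add, map_add, hp, hq, map_add]
  | mul_X p i hp =>
    have h1 : pderiv e (edgeSubst c (X i)) = C (c e i) := by
      rw [hX, map_sum, Finset.sum_eq_single e]
      · rw [Derivation.map_smul, pderiv_X_self, smul_eq_C_mul, mul_one]
      · intro f _ hf
        rw [Derivation.map_smul, pderiv_X_of_ne hf, smul_zero]
      · simp
    rw [map_mul, Derivation.leibniz, Derivation.leibniz, hp, h1, edgeDeriv_X]
    simp only [smul_eq_mul, map_add, map_mul, hC]

lemma indExp_empty : indExp (∅ : Finset E) = 0 := Finset.sum_empty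

lemma indExp_apply [DecidableEq E] (H : Finset E) (e : E) :
    indExp H e = if e ∈ H then 1 else 0 := by
  simp [indExp, Finsupp.finsetSum_apply, Finsupp.single_apply]

lemma coeff_indExp_insert [Fintype E] [DecidableEq E] {e : E} {H : Finset E} (he : e ∉ H)
    (p : MvPolynomial (Fin n) K) :
    coeff (indExp (insert e H)) (edgeSubst c p) =
      coeff (indExp H) (edgeSubst c (edgeDeriv c e p)) := by
  rw [← pderiv_edgeSubst, coeff_pderiv, indExp_apply, if_neg he, Nat.cast_zero, zero_add, mul_one,
    indExp, Finset.sum_insert he, add_comm]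
  rfl

lemma coeff_zero_edgeSubst [Fintype E] (p : MvPolynomial (Fin n) K) :
    coeff 0 (edgeSubst c p) = coeff 0 p := by
  have h : (constantCoeff : MvPolynomial E K →+* K).comp (edgeSubst c).toRingHom =
      constantCoeff := by
    refine MvPolynomial.ringHom_ext (fun a => ?_) fun i => ?_
    · simp [edgeSubst]
    · simp [edgeSubst, smul_eq_C_mul]
  exact congrArg (fun f => f p) h

lemma mem_slimKernel [Fintype E] [DecidableEq E] {S R : Finset E} {p : MvPolynomial (Fin n) K} :
    p ∈ slimKernel c S R ↔
      ∀ H ⊆ R, Crosses c (R \ H ∪ S) → coeff (indExp H) (edgeSubst c p) = 0 := by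
  unfold slimKernel
  simp only [Set.mem_ofPred_eq]
  refine forall_congr' fun H => forall_congr' fun _ => ?_
  convert Iff.rfl

/-- Sets tested for `insert e R` split by whether they contain `e`: those that do give the tests for
the deletion, treated here; those that do not give the tests for the contraction, treated in
`slimKernel_insert_subset`. -/
lemma edgeDeriv_mem_slimKernel [Fintype E] [DecidableEq E] {S R : Finset E} {e : E} (heR : e ∉ R)
    {p : MvPolynomial (Fin n) K} (hp : p ∈ slimKernel c S (insert e R)) :
    edgeDeriv c e p ∈ slimKernel c S R := by
  rw [mem_slimKernel] at *
  intro H hH hcr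
  rw [← coeff_indExp_insert (fun h => heR (hH h))]
  refine hp _ (Finset.insert_subset_insert _ hH) ?_
  rwa [Finset.insert_sdiff_insert, Finset.sdiff_insert_of_notMem heR]

lemma slimKernel_insert_subset [Fintype E] [DecidableEq E] {S R : Finset E} {e : E} (heR : e ∉ R)
    {p : MvPolynomial (Fin n) K} (hp : p ∈ slimKernel c S (insert e R)) :
    p ∈ slimKernel c (insert e S) R := by
  rw [mem_slimKernel] at *
  intro H hH hcr
  refine hp H (hH.trans (Finset.subset_insert _ _)) ?_
  rw [Finset.insert_sdiff_of_notMem _ fun h => heR (hH h)]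
  rwa [Finset.union_insert, ← Finset.insert_union] at hcr

lemma slimKernel_anti [Fintype E] [DecidableEq E] {S R : Finset E} {e : E}
    {p : MvPolynomial (Fin n) K} (hp : p ∈ slimKernel c S (insert e R)) :
    p ∈ slimKernel c S R := by
  rw [mem_slimKernel] at *
  intro H hH hcr
  exact hp H (hH.trans (Finset.subset_insert _ _))
    (hcr.mono (by gcongr; exact Finset.subset_insert _ _))

lemma coeff_zero_of_mem_powerIdeal [DecidableEq E] {S R : Finset E} (h : Crosses c (R ∪ S))
    {p : MvPolynomial (Fin n) K} (hp : p ∈ powerIdeal c S R) : coeff 0 p = 0 := by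
  classical
  suffices hle : powerIdeal c S R ≤ LinearMap.ker (lcoeff K (0 : Fin n →₀ ℕ)) from hle hp
  refine Submodule.span_le.2 ?_
  rintro _ ⟨g, hg, I, hne, hI, rfl⟩
  change constantCoeff _ = (0 : K)
  obtain ⟨e, he, hw⟩ := h I hne
  have heR : e ∈ R := by
    rcases Finset.mem_union.1 he with h | h
    · exact h
    · exact absurd (hI e h) hw
  have hm : mult c R I ≠ 0 := by
    unfold mult
    exact Finset.card_ne_zero_of_mem (Finset.mem_filter.2 ⟨heR, hw⟩)
  rw [map_mul, map_pow, sumX, map_sum, Finset.sum_eq_zero fun i _ => constantCoeff_X K i,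
    zero_pow hm, zero_mul]

/-- Differentiating along the elements of `H` moves its coefficient to the constant term and deletes
`H` from `R`. What remains still crosses every `I`, so all exponents are positive and the constant
term vanishes. -/
lemma powerIdeal_subset_slimKernel [Fintype E] {S R : Finset E} {p : MvPolynomial (Fin n) K}
    (hp : p ∈ powerIdeal c S R) : p ∈ slimKernel c S R := by
  classical
  rw [mem_slimKernel]
  intro H
  induction H using Finset.induction_on generalizing R p with
  | empty =>
    intro _ hcr
    rw [Finset.sdiff_empty] at hcr
    rw [indExp_empty, coeff_zero_edgeSubst]
    exact coeff_zero_of_mem_powerIdeal hcr hp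
  | insert e H he ih =>
    intro hH hcr
    rw [coeff_indExp_insert he]
    have heR : e ∈ R := hH (Finset.mem_insert_self _ _)
    rw [← Finset.insert_erase heR] at hp
    refine ih (edgeDeriv_mem_powerIdeal c (Finset.notMem_erase e R) hp) ?_ ?_
    · exact Finset.subset_erase.2 ⟨(Finset.subset_insert _ _).trans hH, he⟩
    · rwa [Finset.sdiff_insert, ← Finset.erase_sdiff_comm] at hcr

lemma powerIdeal_empty_of_not_crosses {S : Finset E} (hS : ¬ Crosses c S) :
    powerIdeal c S ∅ = invariants c S := by
  refine le_antisymm (powerIdeal_le_invariants c S ∅) fun p hp => ?_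
  simp only [Crosses, not_forall, not_exists, not_and, not_not] at hS
  obtain ⟨I, hne, hI⟩ := hS
  exact Submodule.subset_span ⟨p, hp, I, hne, hI, by simp [mult]⟩

lemma powerIdeal_insert_of_loop [DecidableEq E] {S R : Finset E} {e : E}
    (h : ∀ I : Finset (Fin n), I.Nonempty → (∀ f ∈ S, weight c f I = 0) → weight c e I = 0) :
    powerIdeal c S (insert e R) = powerIdeal c S R := by
  unfold powerIdeal
  congr 1
  ext p
  constructor
  · rintro ⟨g, hg, I, hne, hI, rfl⟩
    exact ⟨g, hg, I, hne, hI, by rw [mult_of_weight_eq_zero c (h I hne hI)]⟩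
  · rintro ⟨g, hg, I, hne, hI, rfl⟩
    exact ⟨g, hg, I, hne, hI, by rw [mult_of_weight_eq_zero c (h I hne hI)]⟩

lemma mem_invariants_insert [DecidableEq E] {S : Finset E} {e : E} {p : MvPolynomial (Fin n) K} :
    p ∈ invariants c (insert e S) ↔ p ∈ invariants c S ∧ edgeDeriv c e p = 0 := by
  simp only [mem_invariants, Finset.forall_mem_insert, and_comm]

lemma powerIdeal_insert_le [DecidableEq E] {S R : Finset E} {e : E} :
    powerIdeal c (insert e S) R ≤ powerIdeal c S (insert e R) := by
  refine Submodule.span_mono ?_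
  rintro _ ⟨g, hg, I, hne, hI, rfl⟩
  rw [Finset.forall_mem_insert] at hI
  exact ⟨g, (mem_invariants_insert.1 hg).1, I, hne, hI.2, by rw [mult_of_weight_eq_zero c hI.1]⟩

/-- Deletion-contraction: lift the derivative of `p` from the deletion to `q` in the power ideal;
then `p - q` is killed by `e` and belongs to the contraction. -/
theorem mem_powerIdeal_of_mem_slimKernel [Fintype E] [CharZero K] (hc : HasLevels c)
    {S R : Finset E} {p : MvPolynomial (Fin n) K} (hp : p ∈ invariants c S) (h : p ∈ slimKernel c S R) :
    p ∈ powerIdeal c S R := by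
  classical
  induction R using Finset.induction_on generalizing S p with
  | empty =>
    by_cases hS : Crosses c S
    · have h0 := mem_slimKernel.1 h ∅ (Finset.Subset.refl _) (by simpa using hS)
      rw [indExp_empty, coeff_zero_edgeSubst] at h0
      rw [eq_C_of_mem_invariants hc hS hp, h0, map_zero]
      exact zero_mem _
    · rwa [powerIdeal_empty_of_not_crosses hS]
  | insert e R heR ih =>
    by_cases hl : ∀ I : Finset (Fin n), I.Nonempty → (∀ f ∈ S, weight c f I = 0) →
        weight c e I = 0
    · rw [powerIdeal_insert_of_loop hl]
      exact ih hp (slimKernel_anti h)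
    · push Not at hl
      obtain ⟨I, -, hI, hw⟩ := hl
      have h1 := ih (edgeDeriv_mem_invariants c e hp) (edgeDeriv_mem_slimKernel heR h)
      obtain ⟨q, hq, hqe⟩ := exists_mem_powerIdeal_edgeDeriv_eq c heR hI hw h1
      have hsub : p - q ∈ slimKernel c S (insert e R) := by
        have hq' := mem_slimKernel.1 (powerIdeal_subset_slimKernel hq)
        rw [mem_slimKernel] at h ⊢
        intro H hH hcr
        rw [map_sub, coeff_sub, h H hH hcr, hq' H hH hcr, sub_zero]
      have h2 : p - q ∈ powerIdeal c (insert e S) R :=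
        ih (mem_invariants_insert.2 ⟨sub_mem hp (powerIdeal_le_invariants c _ _ hq),
          by rw [map_sub, hqe, sub_self]⟩) (slimKernel_insert_subset heR hsub)
      have := add_mem (powerIdeal_insert_le h2) hq
      rwa [sub_add_cancel] at this

end SlimKernel

/-! ### The codimension of the power ideal counts bases. -/

section Rank

open Module

variable {K : Type*} [Field K] {n : ℕ} {E : Type*}

open Classical in
/-- The bases `T` of the arrangement with `S ⊆ T ⊆ R ∪ S`. -/
noncomputable def basesBetween (c : E → Fin n → K) (S R : Finset E) : Finset (Finset E) :=
  (R ∪ S).powerset.filter fun T => S ⊆ T ∧ LinearIndepOn K c (T : Set E) ∧ Crosses c T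

variable {c : E → Fin n → K}

lemma mem_basesBetween [DecidableEq E] {S R T : Finset E} :
    T ∈ basesBetween c S R ↔
      T ⊆ R ∪ S ∧ S ⊆ T ∧ LinearIndepOn K c (T : Set E) ∧ Crosses c T := by
  classical
  unfold basesBetween
  simp only [Finset.mem_filter, Finset.mem_powerset]
  convert Iff.rfl

/-- Additivity of rank along the exact sequence `0 → U'/N' → U/N → U/N'' → 0`, whose second map is
induced by `D`. The hypothesis `hlift` gives exactness in the middle. -/
lemma rank_quotient_eq_add {V : Type*} [AddCommGroup V] [Module K V] {U U' N N' N'' : Submodule K V}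
    (D : V →ₗ[K] V) (hU' : U' = U ⊓ LinearMap.ker D) (hN' : ∀ p ∈ U', p ∈ N' ↔ p ∈ N)
    (hDN : ∀ p ∈ U, p ∈ N → D p ∈ N'') (hDU : ∀ p ∈ U, D p ∈ U)
    (hsurj : ∀ q ∈ U, ∃ p ∈ U, D p = q)
    (hlift : ∀ p ∈ U, D p ∈ N'' → ∃ q ∈ U, q ∈ N ∧ D q = D p) :
    Module.rank K (U ⧸ N.submoduleOf U) =
      Module.rank K (U' ⧸ N'.submoduleOf U') + Module.rank K (U ⧸ N''.submoduleOf U) := by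
  have hle : U' ≤ U := hU' ▸ inf_le_left
  let g : (U ⧸ N.submoduleOf U) →ₗ[K] (U ⧸ N''.submoduleOf U) :=
    Submodule.mapQ _ _ (D.restrict hDU) fun p hp => hDN p p.2 hp
  let f : (U' ⧸ N'.submoduleOf U') →ₗ[K] (U ⧸ N.submoduleOf U) :=
    Submodule.mapQ _ _ (Submodule.inclusion hle) fun p hp => (hN' p p.2).1 hp
  have hfmk : ∀ p, f (Submodule.Quotient.mk p) =
      Submodule.Quotient.mk (Submodule.inclusion hle p) :=
    fun _ => rfl
  have hgmk : ∀ p, g (Submodule.Quotient.mk p) = Submodule.Quotient.mk (D.restrict hDU p) :=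
    fun _ => rfl
  have hf : Function.Injective f := by
    rw [← LinearMap.ker_eq_bot, LinearMap.ker_eq_bot']
    intro x
    induction x using Submodule.Quotient.induction_on with
    | _ p =>
      intro hp
      rw [hfmk, Submodule.Quotient.mk_eq_zero] at hp
      rw [Submodule.Quotient.mk_eq_zero]
      exact (hN' p p.2).2 hp
  have hg : Function.Surjective g := by
    intro x
    induction x using Submodule.Quotient.induction_on with
    | _ q =>
      obtain ⟨p, hp, hpq⟩ := hsurj q q.2
      exact ⟨Submodule.Quotient.mk ⟨p, hp⟩, congrArg Submodule.Quotient.mk (Subtype.ext hpq)⟩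
  have hfg : LinearMap.range f = LinearMap.ker g := by
    apply le_antisymm
    · rintro _ ⟨x, rfl⟩
      induction x using Submodule.Quotient.induction_on with
      | _ p =>
        have h0 : D p = 0 := (Submodule.mem_inf.1 (hU' ▸ p.2 : (p : V) ∈ U ⊓ LinearMap.ker D)).2
        rw [LinearMap.mem_ker, hfmk, hgmk, Submodule.Quotient.mk_eq_zero]
        change D p ∈ N''
        rw [h0]
        exact zero_mem _
    · intro x
      induction x using Submodule.Quotient.induction_on with
      | _ p =>
        intro hp
        rw [LinearMap.mem_ker, hgmk, Submodule.Quotient.mk_eq_zero] at hp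
        obtain ⟨q, hqU, hqN, hq⟩ := hlift p p.2 hp
        refine ⟨Submodule.Quotient.mk ⟨p - q, ?_⟩, ?_⟩
        · rw [hU']
          exact ⟨sub_mem p.2 hqU, LinearMap.mem_ker.2 (by rw [map_sub, hq, sub_self])⟩
        · rw [hfmk, Submodule.Quotient.eq]
          change (p - q : V) - p ∈ N
          rw [sub_sub_cancel_left]
          exact neg_mem hqN
  rw [LinearMap.rank_eq_of_surjective hg, ← hfg, (LinearEquiv.ofInjective f hf).rank_eq, add_comm]

lemma basesBetween_empty_of_crosses {S : Finset E}
    (hli : LinearIndepOn K c (S : Set E)) (hS : Crosses c S) : basesBetween c S ∅ = {S} := by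
  classical
  ext T
  rw [mem_basesBetween, Finset.mem_singleton, Finset.empty_union]
  refine ⟨fun h => h.1.antisymm h.2.1, ?_⟩
  rintro rfl
  exact ⟨subset_rfl, subset_rfl, hli, hS⟩

lemma basesBetween_empty_of_not_crosses {S : Finset E} (hS : ¬ Crosses c S) :
    basesBetween c S ∅ = ∅ := by
  classical
  refine Finset.eq_empty_of_forall_notMem fun T hT => ?_
  rw [mem_basesBetween, Finset.empty_union] at hT
  rw [hT.1.antisymm hT.2.1] at hT
  exact hS hT.2.2.2

lemma basesBetween_insert_of_mem_span [DecidableEq E] {S R : Finset E} {e : E} (heS : e ∉ S)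
    (he : c e ∈ Submodule.span K (c '' S)) :
    basesBetween c S (insert e R) = basesBetween c S R := by
  ext T
  rw [mem_basesBetween, mem_basesBetween]
  refine ⟨fun ⟨h1, h2, h3, h4⟩ => ⟨?_, h2, h3, h4⟩, fun ⟨h1, h2⟩ => ⟨h1.trans ?_, h2⟩⟩
  · have heT : e ∉ T := by
      intro heT
      have h5 : LinearIndepOn K c (insert e (S : Set E)) := by
        refine h3.mono ?_
        rw [← Finset.coe_insert, Finset.coe_subset]
        exact Finset.insert_subset heT h2
      exact h5.notMem_span_of_insert heS he
    rw [Finset.insert_union] at h1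
    exact (Finset.subset_insert_iff_of_notMem heT).1 h1
  · rw [Finset.insert_union]
    exact Finset.subset_insert _ _

lemma card_basesBetween_insert [DecidableEq E] {S R : Finset E} {e : E} (heS : e ∉ S)
    (heR : e ∉ R) : (basesBetween c S (insert e R)).card =
      (basesBetween c (insert e S) R).card + (basesBetween c S R).card := by
  rw [← Finset.card_union_of_disjoint]
  · congr 1
    ext T
    simp only [Finset.mem_union, mem_basesBetween, Finset.union_insert, Finset.insert_union]
    by_cases heT : e ∈ T
    · constructor
      · rintro ⟨h1, h2, h3⟩
        exact Or.inl ⟨h1, Finset.insert_subset heT h2, h3⟩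
      · rintro (⟨h1, h2, h3⟩ | ⟨h1, h2, h3⟩)
        · exact ⟨h1, (Finset.subset_insert _ _).trans h2, h3⟩
        · exact ⟨h1.trans (Finset.subset_insert _ _), h2, h3⟩
    · rw [Finset.subset_insert_iff_of_notMem heT]
      constructor
      · exact fun h => Or.inr h
      · rintro (⟨h1, h2, h3⟩ | h)
        · exact absurd (h2 (Finset.mem_insert_self _ _)) heT
        · exact h
  · rw [Finset.disjoint_left]
    intro T h1 h2
    have h3 := (mem_basesBetween.1 h2).1 ((mem_basesBetween.1 h1).2.1 (Finset.mem_insert_self _ _))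
    rcases Finset.mem_union.1 h3 with h | h
    exacts [heR h, heS h]

theorem rank_invariants_quotient_powerIdeal [Fintype E] [CharZero K] (hc : HasLevels c)
    {S R : Finset E} (hdisj : Disjoint S R) (hli : LinearIndepOn K c (S : Set E)) :
    Module.rank K (invariants c S ⧸ (powerIdeal c S R).submoduleOf (invariants c S)) =
      (basesBetween c S R).card := by
  classical
  induction R using Finset.induction_on generalizing S with
  | empty =>
    by_cases hS : Crosses c S
    · rw [basesBetween_empty_of_crosses hli hS, Finset.card_singleton, Nat.cast_one]
      let φ : invariants c S →ₗ[K] K := (lcoeff K 0).comp (invariants c S).subtype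
      have hker : (powerIdeal c S ∅).submoduleOf (invariants c S) = LinearMap.ker φ := by
        ext ⟨p, hp⟩
        change p ∈ powerIdeal c S ∅ ↔ coeff 0 p = 0
        refine ⟨coeff_zero_of_mem_powerIdeal (by simpa using hS), fun h0 => ?_⟩
        rw [eq_C_of_mem_invariants hc hS hp, h0, map_zero]
        exact zero_mem _
      have hφ : Function.Surjective φ := fun a =>
        ⟨⟨C a, C_mem_invariants c a⟩, coeff_zero_C a⟩
      rw [hker, (φ.quotKerEquivOfSurjective hφ).rank_eq, rank_self]
    · rw [basesBetween_empty_of_not_crosses hS, Finset.card_empty, Nat.cast_zero,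
        powerIdeal_empty_of_not_crosses hS, Submodule.submoduleOf_self]
      exact rank_subsingleton' _ _
  | insert e R heR ih =>
    rw [Finset.disjoint_insert_right] at hdisj
    by_cases he : c e ∈ Submodule.span K (c '' S)
    · rw [basesBetween_insert_of_mem_span hdisj.1 he, ← ih hdisj.2 hli, powerIdeal_insert_of_loop]
      intro I _ hI
      -- The form of `I` is invariant under `S`, hence under `e` in its span; its derivative along
      -- `e` is the weight.
      have h1 := edgeDeriv_eq_zero_of_mem_span he (by simpa using sumX_pow_mem_invariants c hI 1)
      rwa [edgeDeriv_sumX, C_eq_zero] at h1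
    · obtain ⟨I, hne, hI, hw⟩ := hc.exists_sum_ne_zero he
      rw [card_basesBetween_insert hdisj.1 heR, Nat.cast_add, ← ih hdisj.2 hli,
        ← ih (S := insert e S) (Finset.disjoint_insert_left.2 ⟨heR, hdisj.2⟩)
          (by rw [Finset.coe_insert]; exact hli.insert he)]
      refine rank_quotient_eq_add (edgeDeriv c e).toLinearMap ?_ ?_ ?_ ?_ ?_ ?_
      · ext p
        exact mem_invariants_insert
      · intro p hp
        refine ⟨fun h => powerIdeal_insert_le h, fun h => ?_⟩
        -- This inclusion, giving injectivity from the contraction, is not visible on generators; it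
        -- passes through slim coefficients.
        exact mem_powerIdeal_of_mem_slimKernel hc hp
          (slimKernel_insert_subset heR (powerIdeal_subset_slimKernel h))
      · exact fun p _ hp => edgeDeriv_mem_powerIdeal c heR hp
      · exact fun p hp => edgeDeriv_mem_invariants c e hp
      · intro q hq
        obtain ⟨h, hh, hq'⟩ := exists_edgeDeriv_pow_mul_eq c hI hw hq 0
        rw [pow_zero, one_mul] at hq'
        exact ⟨_, mul_mem_invariants c (sumX_pow_mem_invariants c hI _) hh, hq'⟩
      · intro p _ hp
        obtain ⟨q, hq, hqp⟩ := exists_mem_powerIdeal_edgeDeriv_eq c heR hI hw hp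
        exact ⟨q, powerIdeal_le_invariants c _ _ hq, hq, hqp⟩

end Rank

/-! ### Exponentials and logarithms of nilpotent elements. -/

section NilpotentExp

lemma isNilpotent_finsetSum {A : Type*} [CommRing A] {ι : Type*} (s : Finset ι) {a : ι → A}
    (h : ∀ i ∈ s, IsNilpotent (a i)) : IsNilpotent (∑ i ∈ s, a i) :=
  mem_nilradical.1 (sum_mem fun i hi => mem_nilradical.2 (h i hi))

lemma pow_eq_zero_of_add_eq_zero {A : Type*} [CommRing A] {a b : A} {k : ℕ} (h : a + b = 0)
    (hb : b ^ k = 0) : a ^ k = 0 := by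
  rw [eq_neg_of_add_eq_zero_left h, neg_pow, hb, mul_zero]

variable {A : Type*} [CommRing A] [Module ℚ A]

lemma exists_exp_eq_one_add (K : Type*) [Field K] [CharZero K] [Algebra K A] {a : A}
    (ha : IsNilpotent a) :
    ∃ s ∈ Algebra.adjoin K {a}, IsNilpotent.exp a = 1 + a + a ^ 2 * s := by
  obtain ⟨k, hk⟩ := ha
  have hk2 : a ^ (k + 1 + 1) = 0 := by rw [pow_succ, pow_succ, hk, zero_mul, zero_mul]
  refine ⟨∑ i ∈ Finset.range k, (((i + 1 + 1).factorial : ℚ)⁻¹) • a ^ i, ?_, ?_⟩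
  · refine sum_mem fun i _ => ?_
    rw [← Rat.cast_smul_eq_qsmul K]
    exact Subalgebra.smul_mem _ (pow_mem (Algebra.self_mem_adjoin_singleton K a) i) _
  · rw [IsNilpotent.exp_eq_sum hk2, Finset.sum_range_succ', Finset.sum_range_succ', Finset.mul_sum]
    simp only [zero_add, Nat.factorial_one, Nat.factorial_zero, Nat.cast_one, inv_one, one_smul,
      pow_one, pow_zero]
    rw [add_comm, add_comm _ a, ← add_assoc]
    refine congrArg _ (Finset.sum_congr rfl fun i _ => ?_)
    rw [mul_smul_comm, ← pow_add, add_comm 2 i]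

lemma exists_isUnit_exp_sub_one {a : A} (ha : IsNilpotent a) :
    ∃ u : A, IsUnit u ∧ IsNilpotent.exp a - 1 = a * u := by
  obtain ⟨k, hk⟩ := ha
  have hk2 : a ^ (k + 1 + 1) = 0 := by rw [pow_succ, pow_succ, hk, zero_mul, zero_mul]
  refine ⟨1 + a * ∑ i ∈ Finset.range k, (((i + 1 + 1).factorial : ℚ)⁻¹) • a ^ i, ?_, ?_⟩
  · exact IsNilpotent.isUnit_one_add ((Commute.all _ _).isNilpotent_mul_right ⟨k, hk⟩)
  · rw [IsNilpotent.exp_eq_sum hk2, Finset.sum_range_succ', Finset.sum_range_succ', Finset.mul_sum,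
      mul_add, Finset.mul_sum]
    simp only [zero_add, Nat.factorial_one, Nat.factorial_zero, Nat.cast_one, inv_one, one_smul,
      pow_one, pow_zero, add_sub_cancel_right, mul_one]
    rw [add_comm]
    refine congrArg _ (Finset.sum_congr rfl fun i _ => ?_)
    rw [mul_smul_comm, mul_smul_comm, pow_succ', pow_succ']

lemma exp_injective_of_isNilpotent {a b : A} (ha : IsNilpotent a) (hb : IsNilpotent b)
    (h : IsNilpotent.exp a = IsNilpotent.exp b) : a = b := by
  obtain ⟨u, hu, hu'⟩ := exists_isUnit_exp_sub_one
    ((Commute.all a (-b)).isNilpotent_add ha hb.neg)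
  rw [IsNilpotent.exp_add_of_commute (Commute.all _ _) ha hb.neg, h,
    IsNilpotent.exp_mul_exp_neg_self hb, sub_self] at hu'
  exact add_neg_eq_zero.1 ((hu.mul_left_eq_zero).1 hu'.symm)

/-- The logarithm by successive approximation: `exp (-u) * (1 + u)` differs from `1` by a multiple
of `u ^ 2`, which has smaller nilpotency index. -/
lemma exists_exp_eq_one_add_self (K : Type*) [Field K] [CharZero K] [Algebra K A] {u : A}
    (hu : IsNilpotent u) :
    ∃ a ∈ Algebra.adjoin K {u}, IsNilpotent a ∧ IsNilpotent.exp a = 1 + u := by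
  obtain ⟨k, hk⟩ := hu
  induction k using Nat.strong_induction_on generalizing u with
  | _ k ih =>
    by_cases hk1 : k ≤ 1
    · have hu0 : u = 0 := by simpa using pow_eq_zero_of_le hk1 hk
      exact ⟨0, zero_mem _, IsNilpotent.zero, by rw [IsNilpotent.exp_zero, hu0, add_zero]⟩
    push Not at hk1
    have hu : IsNilpotent u := ⟨k, hk⟩
    have hmem := Algebra.self_mem_adjoin_singleton K u
    obtain ⟨s, hs, hs'⟩ := exists_exp_eq_one_add K hu.neg
    have hs : s ∈ Algebra.adjoin K {u} := by
      refine Algebra.adjoin_le ?_ hs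
      rw [Set.singleton_subset_iff]
      exact neg_mem hmem
    have hw : u ^ 2 * (s * (1 + u) - 1) ∈ Algebra.adjoin K {u} :=
      mul_mem (pow_mem hmem 2) (sub_mem (mul_mem hs (add_mem (one_mem _) hmem)) (one_mem _))
    -- Since `k ≥ 2`, one has `2 * (k - 1) ≥ k`, so the new error vanishes to the power `k - 1`.
    obtain ⟨a, ha, han, hae⟩ := ih (k - 1) (by omega) (u := u ^ 2 * (s * (1 + u) - 1)) (by
      rw [mul_pow, ← pow_mul, pow_eq_zero_of_le (by omega) hk, zero_mul])
    refine ⟨u + a, add_mem hmem (Algebra.adjoin_le (Set.singleton_subset_iff.2 hw) ha),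
      (Commute.all _ _).isNilpotent_add hu han, ?_⟩
    have h1 : 1 + u ^ 2 * (s * (1 + u) - 1) = IsNilpotent.exp (-u) * (1 + u) := by
      rw [hs']
      ring
    rw [IsNilpotent.exp_add_of_commute (Commute.all _ _) hu han, hae, h1, ← mul_assoc,
      IsNilpotent.exp_mul_exp_neg_self hu, one_mul]

lemma exp_finsetSum {ι : Type*} (s : Finset ι) {a : ι → A} (h : ∀ i ∈ s, IsNilpotent (a i)) :
    IsNilpotent.exp (∑ i ∈ s, a i) = ∏ i ∈ s, IsNilpotent.exp (a i) := by
  classical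
  induction s using Finset.induction_on with
  | empty => rw [Finset.sum_empty, Finset.prod_empty, IsNilpotent.exp_zero]
  | insert i s hi ih =>
    rw [Finset.forall_mem_insert] at h
    rw [Finset.sum_insert hi, Finset.prod_insert hi,
      IsNilpotent.exp_add_of_commute (Commute.all _ _) h.1 (isNilpotent_finsetSum s h.2), ih h.2]

lemma exp_mem_of_mem {K : Type*} [Field K] [CharZero K] [Algebra K A] (S : Subalgebra K A) {a : A}
    (ha : IsNilpotent a) (h : a ∈ S) : IsNilpotent.exp a ∈ S := by
  obtain ⟨s, hs, hs'⟩ := exists_exp_eq_one_add K ha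
  have hs : s ∈ S := Algebra.adjoin_le (Set.singleton_subset_iff.2 h) hs
  rw [hs']
  exact add_mem (add_mem (one_mem _) h) (mul_mem (pow_mem h 2) hs)

lemma mem_of_exp_mem {K : Type*} [Field K] [CharZero K] [Algebra K A] (S : Subalgebra K A) {a : A}
    (ha : IsNilpotent a) (h : IsNilpotent.exp a ∈ S) : a ∈ S := by
  obtain ⟨b, hb, hbn, hbe⟩ :=
    exists_exp_eq_one_add_self K (IsNilpotent.isNilpotent_exp_sub_one ha)
  rw [add_sub_cancel] at hbe
  rw [← exp_injective_of_isNilpotent hbn ha hbe]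
  exact Algebra.adjoin_le (Set.singleton_subset_iff.2 (sub_mem h (one_mem _))) hb

lemma exp_sum_sub_one_pow_eq_zero {ι : Type*} {s : Finset ι} {a : ι → A}
    (h : ∀ i ∈ s, IsNilpotent (a i)) (k : ℕ) :
    (∏ i ∈ s, IsNilpotent.exp (a i) - 1) ^ k = 0 ↔ (∑ i ∈ s, a i) ^ k = 0 := by
  obtain ⟨u, hu, hu'⟩ := exists_isUnit_exp_sub_one (isNilpotent_finsetSum s h)
  rw [← exp_finsetSum s h, hu', mul_pow, (hu.pow k).mul_left_eq_zero]

end NilpotentExp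

/-! ### The isomorphism between the additive algebra `B` and the multiplicative algebra `D`. -/

section Graph

variable {n : ℕ} {β : Type*} (G : Graph (Fin (n + 1)) β)

lemma cutSize_compl (I : Finset (Fin (n + 1))) : cutSize G Iᶜ = cutSize G I := by
  unfold cutSize
  congr 1
  ext e
  simp only [Set.mem_ofPred_eq, Finset.mem_compl, not_not]
  constructor
  · rintro ⟨i, hi, j, hj, h⟩
    exact ⟨j, hj, i, hi, h.symm⟩
  · rintro ⟨i, hi, j, hj, h⟩
    exact ⟨j, hj, i, hi, h.symm⟩

lemma exists_map_succEmb_eq {I : Finset (Fin (n + 1))} (h : 0 ∉ I) :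
    ∃ J : Finset (Fin n), J.map (Fin.succEmb n) = I := by
  classical
  refine ⟨Finset.univ.filter fun j => j.succ ∈ I, ?_⟩
  ext i
  rw [Finset.mem_map]
  cases i using Fin.cases with
  | zero => simp [h]
  | succ i => simp

variable (K : Type*) [Field K]

lemma sum_mk_X_pow_cutSize_BT {I : Finset (Fin n)} (hI : I.Nonempty) :
    (∑ i ∈ I, (Ideal.Quotient.mk (idealBT K G) (X i))) ^ cutSize G (I.map (Fin.succEmb n)) = 0 := by
  rw [← map_sum, ← map_pow, Ideal.Quotient.eq_zero_iff_mem]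
  exact Ideal.subset_span ⟨I, hI, rfl⟩

lemma isNilpotent_mk_X_BT (i : Fin n) :
    IsNilpotent (Ideal.Quotient.mk (idealBT K G) (X i)) :=
  ⟨_, by simpa using sum_mk_X_pow_cutSize_BT G K (Finset.singleton_nonempty i)⟩

lemma prod_mk_X_DT : ∏ i, Ideal.Quotient.mk (idealDT K G) (X i) = 1 := by
  rw [← map_prod, ← sub_eq_zero, ← map_one (Ideal.Quotient.mk (idealDT K G)), ← map_sub,
    Ideal.Quotient.eq_zero_iff_mem]
  exact Ideal.subset_span (Or.inr rfl)

lemma prod_mk_X_sub_one_pow_cutSize_DT {I : Finset (Fin (n + 1))} (hI : I.Nonempty)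
    (hI' : I ≠ Finset.univ) :
    (∏ i ∈ I, (Ideal.Quotient.mk (idealDT K G) (X i)) - 1) ^ cutSize G I = 0 := by
  rw [← map_prod, ← map_one (Ideal.Quotient.mk (idealDT K G)), ← map_sub, ← map_pow,
    Ideal.Quotient.eq_zero_iff_mem]
  exact Ideal.subset_span (Or.inl ⟨I, hI, hI', rfl⟩)

lemma isNilpotent_mk_X_sub_one_DT (i : Fin (n + 1)) :
    IsNilpotent (Ideal.Quotient.mk (idealDT K G) (X i) - 1) := by
  -- When `n = 0` the singleton is not a proper subset, and the product relation takes over.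
  by_cases h : {i} = (Finset.univ : Finset (Fin (n + 1)))
  · have h1 := prod_mk_X_DT G K
    rw [← h, Finset.prod_singleton] at h1
    rw [h1, sub_self]
    exact IsNilpotent.zero
  · exact ⟨_, by
      simpa using prod_mk_X_sub_one_pow_cutSize_DT G K (Finset.singleton_nonempty i) h⟩

lemma map_succEmb_ne_univ (I : Finset (Fin n)) : I.map (Fin.succEmb n) ≠ Finset.univ := by
  intro h
  have := h ▸ Finset.mem_univ (0 : Fin (n + 1))
  simp at this

theorem nonempty_BT_equiv_DT [CharZero K] : Nonempty (BT K G ≃ₐ[K] DT K G) := by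
  classical
  let y : Fin (n + 1) → DT K G := fun i => Ideal.Quotient.mk (idealDT K G) (X i)
  let x : Fin n → BT K G := fun i => Ideal.Quotient.mk (idealBT K G) (X i)
  have hx : ∀ i, IsNilpotent (x i) := isNilpotent_mk_X_BT G K
  have hlog (i : Fin (n + 1)) : ∃ a : DT K G, IsNilpotent a ∧ IsNilpotent.exp a = y i := by
    obtain ⟨a, -, ha, ha'⟩ := exists_exp_eq_one_add_self K (isNilpotent_mk_X_sub_one_DT G K i)
    rw [add_sub_cancel] at ha'
    exact ⟨a, ha, ha'⟩
  choose l hl hle using hlog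
  have hlsum : ∑ i, l i = 0 := by
    refine exp_injective_of_isNilpotent (isNilpotent_finsetSum _ fun i _ => hl i)
      IsNilpotent.zero ?_
    rw [exp_finsetSum _ fun i _ => hl i, IsNilpotent.exp_zero,
      Finset.prod_congr rfl fun i _ => hle i]
    exact prod_mk_X_DT G K
  -- The missing variable at vertex `0` is chosen to make the total sum zero, matching `∏ y_i = 1`.
  let z : Fin (n + 1) → BT K G := Fin.cons (-∑ i, x i) x
  have hz : ∀ i, IsNilpotent (z i) := by
    intro i
    cases i using Fin.cases with
    | zero => exact (isNilpotent_finsetSum _ fun i _ => hx i).neg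
    | succ i => exact hx i
  have hzsum : ∑ i, z i = 0 := by
    rw [Fin.sum_univ_succ]
    simp [z]
  have hzpow (I : Finset (Fin (n + 1))) (hI : I.Nonempty) (h0 : 0 ∉ I) :
      (∑ i ∈ I, z i) ^ cutSize G I = 0 := by
    obtain ⟨J, rfl⟩ := exists_map_succEmb_eq h0
    rw [Finset.sum_map]
    exact sum_mk_X_pow_cutSize_BT G K (Finset.map_nonempty.1 hI)
  let f : BT K G →ₐ[K] DT K G := Ideal.Quotient.liftₐ (idealBT K G) (aeval fun i => l i.succ) (by
    change idealBT K G ≤ RingHom.ker (aeval fun i => l i.succ : MvPolynomial (Fin n) K →ₐ[K] DT K G)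
    refine Ideal.span_le.2 ?_
    rintro _ ⟨I, hI, rfl⟩
    change aeval _ _ = _
    rw [map_pow, map_sum]
    simp only [aeval_X]
    have h1 := prod_mk_X_sub_one_pow_cutSize_DT G K
      ((Finset.map_nonempty (f := Fin.succEmb n)).2 hI)
      (map_succEmb_ne_univ I)
    rw [← Finset.prod_congr rfl fun i _ => hle i, exp_sum_sub_one_pow_eq_zero fun i _ => hl i,
      Finset.sum_map] at h1
    exact h1)
  let g : DT K G →ₐ[K] BT K G := Ideal.Quotient.liftₐ (idealDT K G)
    (aeval fun i => IsNilpotent.exp (z i)) (by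
    change idealDT K G ≤ RingHom.ker
      (aeval fun i => IsNilpotent.exp (z i) : MvPolynomial (Fin (n + 1)) K →ₐ[K] BT K G)
    refine Ideal.span_le.2 ?_
    rintro _ (⟨I, hI, hI', rfl⟩ | rfl)
    · change aeval _ _ = _
      rw [map_pow, map_sub, map_one, map_prod]
      simp only [aeval_X]
      rw [exp_sum_sub_one_pow_eq_zero fun i _ => hz i]
      -- A set containing `0` is replaced by its complement: the sum changes sign and the cut stays
      -- the same.
      by_cases h0 : 0 ∈ I
      · have h1 := hzpow Iᶜ (by
          rwa [← Finset.compl_ne_univ_iff_nonempty, compl_compl]) (by simpa using h0)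
        rw [← Finset.sum_add_sum_compl I z] at hzsum
        rw [cutSize_compl] at h1
        exact pow_eq_zero_of_add_eq_zero hzsum h1
      · exact hzpow I hI h0
    · change aeval _ _ = _
      rw [map_sub, map_one, map_prod]
      simp only [aeval_X]
      rw [← exp_finsetSum _ fun i _ => hz i, hzsum, IsNilpotent.exp_zero, sub_self])
  have hf : ∀ i, f (x i) = l i.succ := fun i => by
    change aeval _ (X i) = _
    rw [aeval_X]
  have hg : ∀ i, g (y i) = IsNilpotent.exp (z i) := fun i => by
    change aeval _ (X i) = _
    rw [aeval_X]
  have hfz : ∀ i, f (z i) = l i := by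
    intro i
    cases i using Fin.cases with
    | zero =>
      rw [Fin.sum_univ_succ] at hlsum
      change f (-∑ i, x i) = _
      rw [map_neg, map_sum, eq_neg_of_add_eq_zero_left hlsum]
      simp only [hf]
    | succ i => exact hf i
  refine ⟨AlgEquiv.ofAlgHom f g ?_ ?_⟩
  · refine Ideal.Quotient.algHom_ext _ (MvPolynomial.algHom_ext fun i => ?_)
    change f (g (y i)) = y i
    rw [hg, IsNilpotent.map_exp (hz i), hfz, hle]
  · refine Ideal.Quotient.algHom_ext _ (MvPolynomial.algHom_ext fun i => ?_)
    change g (f (x i)) = x i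
    rw [hf]
    refine exp_injective_of_isNilpotent ((hl _).map g) (hx i) ?_
    rw [← IsNilpotent.map_exp (hl _), hle, hg]
    rfl

end Graph

/-! ### Incidence vectors, connectedness and spanning trees. -/

section Endpoints

variable (K : Type*) [Field K] {n : ℕ} {β : Type*} (G : Graph (Fin (n + 1)) β)

/-- The vector of the coefficients `c_{i,e}`, `i = 1, …, n`. -/
noncomputable def incidence (e : G.edgeSet) (i : Fin n) : K := sgn K G i.succ e

lemma exists_lt_isLink [G.Loopless] (e : G.edgeSet) : ∃ a b, a < b ∧ G.IsLink (e : β) a b := by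
  obtain ⟨a, b, h⟩ := G.exists_isLink_of_mem_edgeSet e.2
  rcases lt_trichotomy a b with hab | rfl | hab
  · exact ⟨a, b, hab, h⟩
  · exact absurd h (Graph.Loopless.not_isLoopAt _ _)
  · exact ⟨b, a, hab, h.symm⟩

lemma sgn_eq_sub {e : G.edgeSet} {a b : Fin (n + 1)} (hab : a < b) (h : G.IsLink (e : β) a b)
    (i : Fin (n + 1)) : sgn K G i e = (if i = a then 1 else 0) - (if i = b then 1 else 0) := by
  have h1 : (∃ j, G.IsLink (e : β) i j ∧ i < j) ↔ i = a := by
    constructor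
    · rintro ⟨j, hj, hij⟩
      rcases h.eq_and_eq_or_eq_and_eq hj with ⟨h1, h2⟩ | ⟨h1, h2⟩
      · exact h1.symm
      · exact absurd (h1 ▸ h2 ▸ hij) hab.not_gt
    · rintro rfl
      exact ⟨b, h, hab⟩
  have h2 : (∃ j, G.IsLink (e : β) i j ∧ j < i) ↔ i = b := by
    constructor
    · rintro ⟨j, hj, hij⟩
      rcases h.eq_and_eq_or_eq_and_eq hj with ⟨h1, h2⟩ | ⟨h1, h2⟩
      · exact absurd (h1 ▸ h2 ▸ hij) hab.not_gt
      · exact h2.symm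
    · rintro rfl
      exact ⟨a, h.symm, hab⟩
  unfold sgn
  simp only [h1, h2]
  by_cases ha : i = a
  · rw [if_pos ha, if_pos ha, if_neg (ha ▸ hab.ne), sub_zero]
  · rw [if_neg ha, if_neg ha, zero_sub]
    split_ifs <;> simp

lemma sum_sgn_mul {e : G.edgeSet} {a b : Fin (n + 1)} (hab : a < b) (h : G.IsLink (e : β) a b)
    (v : Fin (n + 1) → K) : ∑ i, sgn K G i e * v i = v a - v b := by
  simp [sgn_eq_sub K G hab h, sub_mul, Finset.sum_sub_distrib]

lemma sum_incidence_mul {e : G.edgeSet} {a b : Fin (n + 1)} (hab : a < b)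
    (h : G.IsLink (e : β) a b) {v : Fin (n + 1) → K} (hv : v 0 = 0) :
    ∑ i, incidence K G e i * v i.succ = v a - v b := by
  rw [← sum_sgn_mul K G hab h v, Fin.sum_univ_succ, hv, mul_zero, zero_add]
  rfl

lemma weight_incidence {e : G.edgeSet} {a b : Fin (n + 1)} (hab : a < b)
    (h : G.IsLink (e : β) a b) (I : Finset (Fin n)) :
    weight (incidence K G) e I =
      (if a ∈ I.map (Fin.succEmb n) then 1 else 0) -
        (if b ∈ I.map (Fin.succEmb n) then 1 else 0) := by
  rw [← sum_incidence_mul K G hab h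
    (v := fun i => if i ∈ I.map (Fin.succEmb n) then (1 : K) else 0) (by simp)]
  simp [weight]

lemma weight_incidence_ne_zero_iff [G.Loopless] (e : G.edgeSet) (I : Finset (Fin n)) :
    weight (incidence K G) e I ≠ 0 ↔
      ∃ i ∈ I.map (Fin.succEmb n), ∃ j ∉ I.map (Fin.succEmb n), G.IsLink (e : β) i j := by
  obtain ⟨a, b, hab, h⟩ := exists_lt_isLink G e
  rw [weight_incidence K G hab h]
  constructor
  · intro hne
    by_cases ha : a ∈ I.map (Fin.succEmb n) <;> by_cases hb : b ∈ I.map (Fin.succEmb n)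
    · simp [ha, hb] at hne
    · exact ⟨a, ha, b, hb, h⟩
    · exact ⟨b, hb, a, ha, h.symm⟩
    · simp [ha, hb] at hne
  · rintro ⟨i, hi, j, hj, hij⟩
    rcases h.eq_and_eq_or_eq_and_eq hij with ⟨rfl, rfl⟩ | ⟨rfl, rfl⟩
    · rw [if_pos hi, if_neg hj, sub_zero]
      exact one_ne_zero
    · rw [if_pos hi, if_neg hj, zero_sub]
      exact neg_ne_zero.2 one_ne_zero

lemma hasLevels_incidence [G.Loopless] : HasLevels (incidence K G) := by
  classical
  intro u e t ht hu
  obtain ⟨a, b, hab, h⟩ := exists_lt_isLink G e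
  -- Vertex `0` gets potential zero. Orthogonality then says that both ends of `e` have equal
  -- potential, and a nonzero level avoids vertex `0`, so it contains both ends or neither.
  let v : Fin (n + 1) → K := Fin.cons 0 u
  have h1 : v a = v b := by
    have := sum_incidence_mul K G hab h (v := v) rfl
    rw [← sub_eq_zero, ← this]
    exact hu
  have h2 := sum_incidence_mul K G hab h (v := fun i => if v i = t then 1 else 0)
    (if_neg (fun h0 : (0 : K) = t => ht h0.symm))
  simp only [h1, sub_self] at h2
  rw [weight, Finset.sum_filter]
  simpa [v] using h2

lemma mult_incidence [G.Loopless] [Fintype G.edgeSet] (I : Finset (Fin n)) :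
    mult (incidence K G) Finset.univ I = cutSize G (I.map (Fin.succEmb n)) := by
  classical
  unfold mult cutSize
  rw [← Set.ncard_coe_finset]
  congr 1
  ext e
  simp only [Finset.coe_filter, Finset.mem_univ, true_and, Set.mem_ofPred_eq]
  exact weight_incidence_ne_zero_iff K G e I

/-- Each cut has a side avoiding `0`, so subsets of `{1, …, n}` see all cuts. If `T` is
disconnected, the vertices unreachable from `0` form an uncrossed set. -/
lemma crosses_incidence_iff [G.Loopless] (T : Finset G.edgeSet) :
    Crosses (incidence K G) T ↔ (adjGraph G (T : Set G.edgeSet)).Connected := by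
  classical
  constructor
  · intro h
    have key : ∀ i, (adjGraph G (T : Set G.edgeSet)).Reachable 0 i := by
      by_contra! hcon
      obtain ⟨i, hi⟩ := hcon
      obtain ⟨I, hI⟩ := exists_map_succEmb_eq
        (I := Finset.univ.filter fun j => ¬ (adjGraph G (T : Set G.edgeSet)).Reachable 0 j)
        (by simp)
      have hne : I.Nonempty := by
        rw [← Finset.map_nonempty (f := Fin.succEmb n), hI]
        exact ⟨i, by simpa using hi⟩
      obtain ⟨e, he, hw⟩ := h I hne
      rw [weight_incidence_ne_zero_iff, hI] at hw
      obtain ⟨a, ha, b, hb, hab⟩ := hw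
      simp only [Finset.mem_filter, Finset.mem_univ, true_and, not_not] at ha hb
      refine ha (hb.trans (SimpleGraph.Adj.reachable ?_))
      exact ⟨fun h0 => ha (h0 ▸ hb), e, he, hab.symm⟩
    exact SimpleGraph.Connected.mk fun i j => (key i).symm.trans (key j)
  · intro h I ⟨i, hi⟩
    by_contra! hcon
    have key : ∀ {a b} (p : (adjGraph G (T : Set G.edgeSet)).Walk a b),
        a ∈ I.map (Fin.succEmb n) → b ∈ I.map (Fin.succEmb n) := by
      intro a b p
      induction p with
      | nil => exact id
      | cons hadj _ ih =>
        intro ha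
        refine ih ?_
        by_contra hb
        obtain ⟨-, e, he, hl⟩ := hadj
        exact (weight_incidence_ne_zero_iff K G e I).2 ⟨_, ha, _, hb, hl⟩ (hcon e he)
    obtain ⟨p⟩ := h.preconnected i.succ 0
    simpa using key p (Finset.mem_map_of_mem _ hi)

lemma linearIndepOn_iff_card {E : Type*} {c : E → Fin n → K} {T : Finset E}
    (hT : Submodule.span K (c '' T) = ⊤) : LinearIndepOn K c (T : Set E) ↔ T.card = n := by
  have hr : Set.range (fun x : (T : Set E) => c x) = c '' T := by
    rw [Set.image_eq_range]
  constructor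
  · intro h
    have hb := Module.finrank_eq_card_basis (Module.Basis.mk h (by rw [hr, hT]))
    rw [Module.finrank_fin_fun] at hb
    simpa using hb.symm
  · intro h
    refine linearIndependent_of_top_le_span_of_card_eq_finrank (by rw [hr, hT]) ?_
    rw [Module.finrank_fin_fun]
    simpa using h

/-- Sending an edge to its pair of ends maps `T` onto the edges of `adjGraph`, injectively exactly
when there are no parallel edges. Connectedness requires at least `n` simple edges, so `n` edges in
`T` force a bijection. -/
lemma isSpanningTree_iff [G.Loopless] (T : Finset G.edgeSet) :
    IsSpanningTree G (T : Set G.edgeSet) ↔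
      (adjGraph G (T : Set G.edgeSet)).Connected ∧ T.card = n := by
  classical
  have hadj (e : T) : ∃ q : (adjGraph G (T : Set G.edgeSet)).edgeSet,
      ∀ i j, G.IsLink ((e : G.edgeSet) : β) i j ↔ (q : Sym2 (Fin (n + 1))) = s(i, j) := by
    obtain ⟨a, b, hab, h⟩ := exists_lt_isLink G e
    refine ⟨⟨s(a, b), ⟨hab.ne, e, e.2, h⟩⟩, fun i j => ?_⟩
    rw [h.isLink_iff_sym2_eq]
  choose q hq using hadj
  have hsurj : Function.Surjective q := by
    rintro ⟨x, hx⟩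
    induction x using Sym2.ind with
    | _ i j =>
      obtain ⟨-, e, he, h⟩ := hx
      exact ⟨⟨e, he⟩, Subtype.ext ((hq ⟨e, he⟩ i j).1 h)⟩
  have hinj : Function.Injective q ↔ ∀ e ∈ (T : Set G.edgeSet), ∀ f ∈ (T : Set G.edgeSet), ∀ i j,
      G.IsLink (e : β) i j → G.IsLink (f : β) i j → e = f := by
    constructor
    · intro h e he f hf i j hi hj
      have h1 := (hq ⟨e, he⟩ i j).1 hi
      have h2 := (hq ⟨f, hf⟩ i j).1 hj
      exact congrArg Subtype.val (h (Subtype.ext (h1.trans h2.symm)))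
    · intro h e f hef
      obtain ⟨a, b, -, hab⟩ := exists_lt_isLink G e
      exact Subtype.ext (h e e.2 f f.2 a b hab ((hq f a b).2 (hef ▸ (hq e a b).1 hab)))
  have hcard : Nat.card T = T.card := Nat.card_eq_finsetCard T
  unfold IsSpanningTree
  rw [← hinj, SimpleGraph.isTree_iff_connected_and_card,
    Nat.card_eq_fintype_card (α := Fin (n + 1)), Fintype.card_fin, Nat.add_right_cancel_iff, and_assoc, ← hcard]
  refine and_congr_right fun hconn => ⟨fun ⟨h1, h2⟩ => ?_, fun h => ?_⟩
  · rw [Nat.card_eq_of_bijective q ⟨h2, hsurj⟩, h1]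
  · have h1 := hconn.card_vert_le_card_edgeSet_add_one
    rw [Nat.card_eq_fintype_card (α := Fin (n + 1)), Fintype.card_fin] at h1
    have h2 := Nat.card_le_card_of_surjective q hsurj
    have h3 : Nat.card T = Nat.card (adjGraph G (T : Set G.edgeSet)).edgeSet := by omega
    exact ⟨h3 ▸ h, ((Nat.bijective_iff_surjective_and_card q).2 ⟨hsurj, h3⟩).1⟩

theorem numSpanningTrees_eq_card_basesBetween [G.Loopless] [Fintype G.edgeSet] :
    numSpanningTrees G = (basesBetween (incidence K G) ∅ Finset.univ).card := by
  classical
  rw [← Set.ncard_coe_finset, numSpanningTrees,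
    ← Set.ncard_image_of_injective _ (Finset.coe_injective (α := G.edgeSet))]
  congr 1
  ext T
  obtain ⟨T, rfl⟩ : ∃ T' : Finset G.edgeSet, (T' : Set G.edgeSet) = T :=
    ⟨T.toFinset, Set.coe_toFinset T⟩
  rw [Set.mem_ofPred_eq, isSpanningTree_iff, Finset.coe_injective.mem_set_image, Finset.mem_coe,
    mem_basesBetween, ← crosses_incidence_iff K]
  simp only [Finset.union_empty, Finset.subset_univ, Finset.empty_subset, true_and]
  rw [and_comm]
  exact and_congr_left fun h =>
    (linearIndepOn_iff_card K ((hasLevels_incidence K G).span_eq_top h)).symm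

end Endpoints

/-! ### The subalgebras of `Φ_G^T` and the assembly of the result. -/

section SlimAlgebra

variable {K : Type*} [Field K] {n : ℕ} {β : Type*} {G : Graph (Fin (n + 1)) β}

lemma IsSlim.mono {H H' : Set G.edgeSet} (h : IsSlim G H) (hle : H' ⊆ H) : IsSlim G H' := by
  refine SimpleGraph.Connected.mono ?_ h
  rintro i j ⟨hne, e, he, hl⟩
  exact ⟨hne, e, Set.compl_subset_compl.2 hle he, hl⟩

lemma prod_X_eq_monomial {E : Type*} (H : Finset E) :
    (∏ e ∈ H, X e : MvPolynomial E K) = monomial (indExp H) 1 := by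
  rw [indExp, monomial_sum_one]
  rfl

/-- No generator of the ideal divides a squarefree slim monomial. Allowing every `m ≤ indExp H`
makes the claim stable under multiplication by polynomials. -/
lemma coeff_eq_zero_of_mem_phiIdeal {q : MvPolynomial G.edgeSet K} (hq : q ∈ phiIdeal K G)
    {H : Finset G.edgeSet} (hH : IsSlim G (H : Set G.edgeSet)) {m : G.edgeSet →₀ ℕ}
    (hm : m ≤ indExp H) : coeff m q = 0 := by
  classical
  induction hq using Submodule.span_induction generalizing m with
  | zero => exact coeff_zero _
  | add p q _ _ hp hq => rw [coeff_add, hp hm, hq hm, add_zero]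
  | mem p hp =>
    rcases hp with ⟨e, rfl⟩ | ⟨H', hH', rfl⟩
    · rw [X_pow_eq_monomial, coeff_monomial, if_neg]
      rintro rfl
      have := hm e
      rw [indExp_apply, Finsupp.single_eq_same] at this
      split_ifs at this <;> omega
    · rw [prod_X_eq_monomial, coeff_monomial, if_neg]
      rintro rfl
      refine hH' (hH.mono (Finset.coe_subset.2 fun e he => ?_))
      have := hm e
      rw [indExp_apply, indExp_apply, if_pos he] at this
      by_contra h
      rw [if_neg h] at this
      omega
  | smul a p _ hp =>
    rw [smul_eq_mul, coeff_mul]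
    refine Finset.sum_eq_zero fun x hx => ?_
    rw [hp (le_trans ?_ hm), mul_zero]
    rw [← Finset.HasAntidiagonal.mem_antidiagonal.1 hx]
    exact le_add_self

lemma phi_mul_self (e : G.edgeSet) : phi K G e * phi K G e = 0 := by
  rw [phi, ← map_mul, Ideal.Quotient.eq_zero_iff_mem, ← pow_two]
  exact Ideal.subset_span (Or.inl ⟨e, rfl⟩)

lemma isNilpotent_smul_phi (e : G.edgeSet) (a : K) : IsNilpotent (a • phi K G e) :=
  ⟨2, by rw [pow_two, smul_mul_smul_comm, phi_mul_self, smul_zero]⟩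

lemma prod_phi_eq_zero {H : Finset G.edgeSet} (hH : ¬ IsSlim G (H : Set G.edgeSet)) :
    ∏ e ∈ H, phi K G e = 0 := by
  simp only [phi]
  rw [← map_prod, Ideal.Quotient.eq_zero_iff_mem]
  exact Ideal.subset_span (Or.inr ⟨H, hH, rfl⟩)

lemma add_pow_succ_of_mul_self_eq_zero {A : Type*} [CommRing A] {a : A} (ha : a * a = 0) (s : A)
    (k : ℕ) : (a + s) ^ (k + 1) = s ^ (k + 1) + (k + 1) * (a * s ^ k) := by
  induction k with
  | zero => simp [add_comm]
  | succ k ih =>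
    rw [pow_succ, ih]
    push_cast
    linear_combination ((k : A) + 1) * s ^ k * ha

/-- When all squares vanish, only the product of all the terms can survive in this power. -/
lemma exists_sum_pow_card_eq {A ι : Type*} [CommRing A] {a : ι → A} (ha : ∀ i, a i * a i = 0)
    (F : Finset ι) : ∃ m : ℕ, (∑ i ∈ F, a i) ^ F.card = m * ∏ i ∈ F, a i := by
  classical
  induction F using Finset.induction_on with
  | empty => exact ⟨1, by simp⟩
  | insert i F hi ih =>
    obtain ⟨m, hm⟩ := ih
    have h0 : (∑ i ∈ F, a i) * ∏ i ∈ F, a i = 0 := by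
      rw [Finset.sum_mul]
      refine Finset.sum_eq_zero fun j hj => ?_
      rw [← Finset.mul_prod_erase F a hj, ← mul_assoc, ha, zero_mul]
    refine ⟨(F.card + 1) * m, ?_⟩
    rw [Finset.sum_insert hi, Finset.prod_insert hi, Finset.card_insert_of_notMem hi,
      add_pow_succ_of_mul_self_eq_zero (ha i), pow_succ, hm]
    push_cast
    linear_combination (m : A) * h0

variable [Fintype G.edgeSet]

lemma sum_genX_eq (I : Finset (Fin n)) :
    ∑ i ∈ I, genX K G i.succ = ∑ e, weight (incidence K G) e I • phi K G e := by
  simp only [genX, weight, incidence, Finset.sum_smul]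
  exact Finset.sum_comm

lemma sum_genX_pow_cutSize [G.Loopless] {I : Finset (Fin n)} (hI : I.Nonempty) :
    (∑ i ∈ I, genX K G i.succ) ^ cutSize G (I.map (Fin.succEmb n)) = 0 := by
  classical
  let F : Finset G.edgeSet := Finset.univ.filter fun e => weight (incidence K G) e I ≠ 0
  have hF : cutSize G (I.map (Fin.succEmb n)) = F.card := by
    rw [← mult_incidence K G I, mult]
  -- `F` is the whole cut of `I`, so no edge outside it crosses `I`.
  have hslim : ¬ IsSlim G (F : Set G.edgeSet) := by
    rw [IsSlim, ← Finset.coe_compl, ← crosses_incidence_iff K]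
    intro h
    obtain ⟨e, he, hw⟩ := h I hI
    exact Finset.mem_compl.1 he (Finset.mem_filter.2 ⟨Finset.mem_univ e, hw⟩)
  obtain ⟨m, hm⟩ := exists_sum_pow_card_eq (a := fun e => weight (incidence K G) e I • phi K G e)
    (fun e => by rw [smul_mul_smul_comm, phi_mul_self, smul_zero]) F
  have hsum : ∑ e, weight (incidence K G) e I • phi K G e =
      ∑ e ∈ F, weight (incidence K G) e I • phi K G e := by
    refine (Finset.sum_subset (Finset.subset_univ F) fun e _ he => ?_).symm
    rw [show weight (incidence K G) e I = 0 by simpa [F] using he, zero_smul]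
  rw [sum_genX_eq, hF, hsum, hm, Finset.prod_smul, prod_phi_eq_zero hslim, smul_zero, mul_zero]

/-- The surjection of the polynomial ring onto `CT`, as a map to `PhiT`. -/
noncomputable def evalGenX (K : Type*) [Field K] (G : Graph (Fin (n + 1)) β) [Fintype G.edgeSet] :
    MvPolynomial (Fin n) K →ₐ[K] PhiT K G :=
  aeval fun i => genX K G i.succ

lemma evalGenX_eq_mk (p : MvPolynomial (Fin n) K) :
    evalGenX K G p = Ideal.Quotient.mk (phiIdeal K G) (edgeSubst (incidence K G) p) := by
  have h : evalGenX K G =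
      (Ideal.Quotient.mkₐ K (phiIdeal K G)).comp (edgeSubst (incidence K G)) := by
    refine MvPolynomial.algHom_ext fun i => ?_
    rw [AlgHom.comp_apply, evalGenX, edgeSubst, aeval_X, aeval_X, map_sum]
    simp only [map_smul]
    rfl
  exact congrArg (fun f => f p) h

lemma mul_mem_powerIdeal_empty {E : Type*} {c : E → Fin n → K} {R : Finset E}
    {p : MvPolynomial (Fin n) K} (a : MvPolynomial (Fin n) K) (hp : p ∈ powerIdeal c ∅ R) :
    a * p ∈ powerIdeal c ∅ R := by
  suffices h : powerIdeal c ∅ R ≤ (powerIdeal c ∅ R).comap (LinearMap.mulLeft K a) from h hp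
  refine Submodule.span_le.2 ?_
  rintro _ ⟨g, -, I, hne, hI, rfl⟩
  refine Submodule.subset_span ⟨a * g, (mem_invariants c).2 (by simp), I, hne, hI, ?_⟩
  exact mul_left_comm _ _ _

lemma mem_powerIdeal_iff_mem_idealBT [G.Loopless] {p : MvPolynomial (Fin n) K} :
    p ∈ powerIdeal (incidence K G) ∅ Finset.univ ↔ p ∈ idealBT K G := by
  constructor
  · intro hp
    suffices h : powerIdeal (incidence K G) ∅ Finset.univ ≤ (idealBT K G).restrictScalars K
      from h hp
    refine Submodule.span_le.2 ?_
    rintro _ ⟨g, -, I, hne, -, rfl⟩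
    refine Ideal.mul_mem_right g (idealBT K G) (Ideal.subset_span ⟨I, hne, ?_⟩)
    rw [mult_incidence]
    rfl
  · intro hp
    induction hp using Submodule.span_induction with
    | zero => exact zero_mem _
    | add p q _ _ hp hq => exact add_mem hp hq
    | smul a p _ hp => exact mul_mem_powerIdeal_empty a hp
    | mem p hp =>
      obtain ⟨I, hne, rfl⟩ := hp
      refine Submodule.subset_span ⟨1, (mem_invariants _).2 (by simp), I, hne, by simp, ?_⟩
      rw [mult_incidence, mul_one]
      rfl

theorem ker_evalGenX [CharZero K] [G.Loopless] : RingHom.ker (evalGenX K G) = idealBT K G := by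
  classical
  refine le_antisymm (fun p hp => ?_) (Ideal.span_le.2 ?_)
  · rw [RingHom.mem_ker, evalGenX_eq_mk, Ideal.Quotient.eq_zero_iff_mem] at hp
    rw [← mem_powerIdeal_iff_mem_idealBT]
    refine mem_powerIdeal_of_mem_slimKernel (hasLevels_incidence K G)
      ((mem_invariants _).2 (by simp)) (mem_slimKernel.2 fun H _ hH => ?_)
    rw [Finset.union_empty, ← Finset.compl_eq_univ_sdiff, crosses_incidence_iff,
      Finset.coe_compl] at hH
    exact coeff_eq_zero_of_mem_phiIdeal hp hH le_rfl
  · rintro _ ⟨I, hI, rfl⟩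
    change evalGenX K G _ = 0
    rw [map_pow, map_sum]
    simp only [evalGenX, aeval_X]
    exact sum_genX_pow_cutSize hI

lemma range_evalGenX : (evalGenX K G).range = CT K G :=
  (Algebra.adjoin_range_eq_range_aeval K _).symm

theorem nonempty_BT_equiv_CT [CharZero K] [G.Loopless] : Nonempty (BT K G ≃ₐ[K] CT K G) :=
  ⟨((Ideal.quotientEquivAlgOfEq K ker_evalGenX.symm).trans
    (Ideal.quotientKerEquivRange (evalGenX K G))).trans
      (Subalgebra.equivOfEq _ _ range_evalGenX)⟩

lemma isNilpotent_genX (i : Fin (n + 1)) : IsNilpotent (genX K G i) :=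
  isNilpotent_finsetSum _ fun _ _ => isNilpotent_smul_phi _ _

lemma exp_genX [CharZero K] (i : Fin (n + 1)) : IsNilpotent.exp (genX K G i) = genY K G i := by
  rw [genX, exp_finsetSum _ fun _ _ => isNilpotent_smul_phi _ _, genY]
  refine Finset.prod_congr rfl fun e _ => ?_
  rw [IsNilpotent.exp_eq_sum (k := 2)
    (by rw [pow_two, smul_mul_smul_comm, phi_mul_self, smul_zero])]
  simp [Finset.sum_range_succ]

lemma sum_genX [G.Loopless] : ∑ i, genX K G i = 0 := by
  simp only [genX]
  rw [Finset.sum_comm]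
  refine Finset.sum_eq_zero fun e _ => ?_
  obtain ⟨a, b, hab, h⟩ := exists_lt_isLink G e
  have h1 := sum_sgn_mul K G hab h fun _ => 1
  simp only [mul_one, sub_self] at h1
  rw [← Finset.sum_smul, h1, zero_smul]

/-- A subalgebra contains a nilpotent element exactly when it contains its exponential, since
exponential and logarithm are polynomials in their argument. The generator at vertex `0` is
redundant because the `X_i^T` sum to zero. -/
theorem CT_eq_KT [CharZero K] [G.Loopless] : CT K G = KT K G := by
  refine le_antisymm (Algebra.adjoin_le ?_) (Algebra.adjoin_le ?_)
  · rintro _ ⟨i, rfl⟩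
    refine mem_of_exp_mem _ (isNilpotent_genX _) ?_
    rw [exp_genX]
    exact Algebra.subset_adjoin ⟨i.succ, rfl⟩
  · rintro _ ⟨i, rfl⟩
    change genY K G i ∈ CT K G
    rw [← exp_genX]
    refine exp_mem_of_mem _ (isNilpotent_genX _) ?_
    have hsucc (i : Fin n) : genX K G i.succ ∈ CT K G := Algebra.subset_adjoin ⟨i, rfl⟩
    cases i using Fin.cases with
    | zero =>
      have h := sum_genX (K := K) (G := G)
      rw [Fin.sum_univ_succ] at h
      rw [eq_neg_of_add_eq_zero_left h]
      exact neg_mem (sum_mem fun i _ => hsucc i)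
    | succ i => exact hsucc i

theorem rank_BT [CharZero K] [G.Loopless] :
    Module.rank K (BT K G) = (numSpanningTrees G : Cardinal) := by
  rw [numSpanningTrees_eq_card_basesBetween K G,
    ← rank_invariants_quotient_powerIdeal (hasLevels_incidence K G) (Finset.disjoint_empty_left _)
      (by rw [Finset.coe_empty]; exact linearIndepOn_empty K _)]
  have hinv : invariants (incidence K G) ∅ = ⊤ :=
    eq_top_iff.2 fun p _ => (mem_invariants _).2 (by simp)
  have hJ : powerIdeal (incidence K G) ∅ Finset.univ = (idealBT K G).restrictScalars K :=
    Submodule.ext fun _ => mem_powerIdeal_iff_mem_idealBT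
  rw [hinv, hJ]
  refine LinearEquiv.rank_eq ?_
  refine (Submodule.Quotient.restrictScalarsEquiv K (idealBT K G)).symm.trans
    (Submodule.Quotient.equiv _ _ Submodule.topEquiv.symm ?_)
  ext ⟨p, hp⟩
  simp [Submodule.submoduleOf]

end SlimAlgebra

end TreeAlgebra

theorem mainTheorem5 (K : Type*) [Field K] [CharZero K] {n : ℕ} {β : Type*}
    (G : Graph (Fin (n + 1)) β) (hV : G.vertexSet = Set.univ) [G.Loopless] [Fintype G.edgeSet] :
    (Nonempty (TreeAlgebra.BT K G ≃ₐ[K] TreeAlgebra.CT K G) ∧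
      Nonempty (TreeAlgebra.BT K G ≃ₐ[K] TreeAlgebra.DT K G) ∧
      Nonempty (TreeAlgebra.BT K G ≃ₐ[K] TreeAlgebra.KT K G)) ∧
    (Module.rank K (TreeAlgebra.BT K G) = (TreeAlgebra.numSpanningTrees G : Cardinal) ∧
      Module.rank K (TreeAlgebra.CT K G) = (TreeAlgebra.numSpanningTrees G : Cardinal) ∧
      Module.rank K (TreeAlgebra.DT K G) = (TreeAlgebra.numSpanningTrees G : Cardinal) ∧
      Module.rank K (TreeAlgebra.KT K G) = (TreeAlgebra.numSpanningTrees G : Cardinal)) := by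
  obtain ⟨eC⟩ := TreeAlgebra.nonempty_BT_equiv_CT (K := K) (G := G)
  obtain ⟨eD⟩ := TreeAlgebra.nonempty_BT_equiv_DT G K
  have eK : TreeAlgebra.BT K G ≃ₐ[K] TreeAlgebra.KT K G :=
    eC.trans (Subalgebra.equivOfEq _ _ TreeAlgebra.CT_eq_KT)
  have hB := TreeAlgebra.rank_BT (K := K) (G := G)
  have hC := LinearEquiv.lift_rank_eq eC.toLinearEquiv
  have hD := LinearEquiv.lift_rank_eq eD.toLinearEquiv
  have hK := LinearEquiv.lift_rank_eq eK.toLinearEquiv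
  rw [hB, Cardinal.lift_natCast, eq_comm, Cardinal.lift_eq_nat_iff] at hC hD hK
  exact ⟨⟨⟨eC⟩, ⟨eD⟩, ⟨eK⟩⟩, hB, hC, hD, hK⟩
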